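/- Setting. Let $J,T,W,N\in\mathbb N$. Potential outcomes $Y_1,\dots,Y_T$ take values in $(0,\bar Y)$, the unobserved heterogeneity $V$ has a Lebesgue density $f_V$ on $[0,1]^J$, and $(V,Y_1,\dots,Y_T)$ is independent of the instruments $Z\in\mathbb R^W$. The marginal treatment responses (MTRs) $m^0_k(v)=E[Y_k\mid V=v]$ are continuous on $(0,1)^J$ with values in $(0,\bar Y)$, and $E[Y_k\mid V]\le E[Y_{k'}\mid V]$ a.s. if $k<k'$. A mechanism $\mathbf d=(d_1,\dots,d_T)$ consists of treatment indicators $d_k(v,q)=\sum_{l\subseteq\{1,\dots,J\}}c^k_l\prod_{j\in l}\mathbf 1\{v_j<q_j\}\in\{0,1\}$ with integer coefficients $c_l^k$ and $\sum_k d_k(v,q)=1$ for all $v,q$. A set $l$ is a leading term of $k$ if $c^k_l\neq0$ and no strictly larger $l'$ has $c^k_{l'}\ne0$. Write $E_l[g](v_l)=\int g(v)\,f_V(v_{l^c}\mid v_l)\,dv_{l^c}$ for the conditional mean of $g(V)$ given the coordinates in $l$. Identified set. Let $K\subseteq\{1,\dots,T\}$. $\mathcal I_K$ is the set of families $(m_k)_{k\in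 K}$ of continuous functions $m_k:(0,1)^J\to(0,\bar Y)$ such that, for each $k\in K$, almost everywhere on the unit cube of the coordinates in $l$: $E_l[m_k]=E_l[m^0_k]$ for each leading term $l$ of $k$; $E_l[m^0_{k'}]\le E_l[m_k]$ for each $k'<k$ and leading term $l$ of $k'$; $E_l[m_k]\le E_l[m^0_{k'}]$ for each $k'>k$ and leading term $l$ of $k'$; and moreover $m_k(V)\le m_{k'}(V)$ a.s. for $k<k'$ in $K$. Leading terms are those of the baseline mechanism $\mathbf d$. Effect. A policy changes $(\mathbf d,Q)$ to $(\mathbf d',Q')$. Fix instrument values $Z^1,\dots,Z^N$ and weights $\omega_o\ge0$ with $\sum_o\omega_o=1$, and let $K$ contain every treatment $k$ for which $d'_k(\cdot,Q'(Z^o))\ne d_k(\cdot,Q(Z^o))$ on $(0,1)^J$ for some $o$. Put $\delta^o(m,v)=\sum_k\big(d'_k(v,Q'(Z^o))-d_k(v,Q(Z^o))\big)m_k(v)$, $\Delta W(m)=\sum_o\omega_o\int\delta^o(m,v)f_V(v)\,dv$ (the GPRTE when the MTRs are $m$), $\underline\delta^o(v)=\inf_{m\in\mathcal I_K}\delta^o(m,v)$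 and $\overline\delta^o(v)=\sup_{m\in\mathcal I_K}\delta^o(m,v)$. Confidence interval. Let $v^o_i$ ($o\le N$, $i\ge1$) be independent draws from the law of $V$. Let $\underline{\Delta W}_M=\sum_o\omega_o\frac1M\sum_{i\le M}\underline\delta^o(v^o_i)$ and $\overline{\Delta W}_M=\sum_o\omega_o\frac1M\sum_{i\le M}\overline\delta^o(v^o_i)$; let $\underline{\hat\sigma}^2=\sum_o\omega_o^2\underline{\hat\sigma}_o^2$ and $\overline{\hat\sigma}^2=\sum_o\omega_o^2\overline{\hat\sigma}_o^2$, where $\underline{\hat\sigma}_o^2,\overline{\hat\sigma}_o^2$ are the unbiased sample variances of $(\underline\delta^o(v^o_i))_{i\le M}$ and $(\overline\delta^o(v^o_i))_{i\le M}$. For $\alpha\in(0,1)$ let $\overline C_M$ solve $$\Phi\Big(\overline C_M+\sqrt M\,\frac{\overline{\Delta W}_M-\underline{\Delta W}_M}{\max(\underline{\hat\sigma},\overline{\hat\sigma})}\Big)-\Phi(-\overline C_M)=1-\alpha,$$ where $\Phi$ is the standard normal distribution function (the quotient is read as $0$ if both standard deviations vanish; the interval below then does not depend on $\overline C_M$),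 and let $$C_{1-\alpha}=\Big[\underline{\Delta W}_M-\overline C_M\,\underline{\hat\sigma}/\sqrt M,\ \overline{\Delta W}_M+\overline C_M\,\overline{\hat\sigma}/\sqrt M\Big].$$ Theorem. The true family $m^0$ lies in $\mathcal I_K$; the identified set $\{\Delta W(m):m\in\mathcal I_K\}$ of the GPRTE is an interval, contained in $\big[\sum_o\omega_oE[\underline\delta^o(V)],\ \sum_o\omega_oE[\overline\delta^o(V)]\big]$; and the limit below exists and satisfies $$\lim_{M\to\infty}\ \inf_{m\in\mathcal I_K}\Pr\big(\Delta W(m)\in C_{1-\alpha}\big)\ \ge\ 1-\alpha .$$ -/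

import Mathlib

open MeasureTheory ProbabilityTheory

namespace HyperRect

/-- The open unit cube `(0,1)^ι`. -/
def openCube (ι : Type) : Set (ι → ℝ) := Set.univ.pi fun _ => Set.Ioo (0 : ℝ) 1

/-! ### Treatment assignment -/

/-- The threshold indicator `S_j(v,q) = 1{v_j < q_j}`. -/
noncomputable def thresholdInd {J : ℕ} (v q : Fin J → ℝ) (j : Fin J) : ℝ :=
  if v j < q j then 1 else 0

/-- The polynomial `∑_l c_l ∏_{j ∈ l} S_j(v,q)` in the threshold indicators. -/
noncomputable def thresholdPoly {J : ℕ} (c : Finset (Fin J) → ℤ) (v q : Fin J → ℝ) : ℝ :=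
  ∑ l : Finset (Fin J), (c l : ℝ) * ∏ j ∈ l, thresholdInd v q j

/-- A treatment assignment mechanism with `T` treatments and `J` thresholds: each treatment
indicator `d_k(v,q)` is an integer polynomial in the threshold indicators, takes the values
`0` and `1` only, and exactly one treatment is assigned at each `(v,q)`. -/
structure Mechanism (J T : ℕ) where
  coef : Fin T → Finset (Fin J) → ℤ
  zero_or_one : ∀ k v q, thresholdPoly (coef k) v q = 0 ∨ thresholdPoly (coef k) v q = 1
  complete : ∀ v q, ∑ k, thresholdPoly (coef k) v q = 1

/-- The treatment indicator `d_k(v,q)`. -/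
noncomputable def Mechanism.d {J T : ℕ} (A : Mechanism J T) (k : Fin T)
    (v q : Fin J → ℝ) : ℝ :=
  thresholdPoly (A.coef k) v q

/-- `l` is a leading term of treatment `k`: it occurs in the decomposition of `d_k`, and it is
included in no other term that occurs there. -/
def Mechanism.IsLeading {J T : ℕ} (A : Mechanism J T) (k : Fin T) (l : Finset (Fin J)) : Prop :=
  A.coef k l ≠ 0 ∧ ∀ l', A.coef k l' ≠ 0 → l ⊆ l' → l' = l

/-! ### The population -/

/-- The population: potential outcomes `Y_k` with values in `(0, Ybar)`, unobserved
heterogeneity `V` with a Lebesgue density `fV` on the unit cube, instruments `Z` independent of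
`(V, Y_1, …, Y_T)`, and the marginal treatment responses `mtr k v = E[Y_k | V = v]`, continuous
on the open cube (for a finite family this is local equicontinuity) and ranked. -/
structure Population (J T W : ℕ) {Ω : Type*} [MeasurableSpace Ω] (P : Measure Ω) where
  Ybar : ℝ
  Y : Fin T → Ω → ℝ
  V : Ω → Fin J → ℝ
  Z : Ω → Fin W → ℝ
  fV : (Fin J → ℝ) → ℝ
  mtr : Fin T → (Fin J → ℝ) → ℝ
  measurable_Y : ∀ k, Measurable (Y k)
  measurable_V : Measurable V
  measurable_Z : Measurable Z
  measurable_fV : Measurable fV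
  fV_nonneg : ∀ v, 0 ≤ fV v
  Y_mem : ∀ k, ∀ᵐ ω ∂P, Y k ω ∈ Set.Ioo 0 Ybar
  law_V : P.map V = (volume.restrict (openCube (Fin J))).withDensity
    fun v => ENNReal.ofReal (fV v)
  indep : IndepFun (fun ω => (V ω, fun k => Y k ω)) Z P
  mtr_continuousOn : ∀ k, ContinuousOn (mtr k) (openCube (Fin J))
  mtr_mem : ∀ k, ∀ v ∈ openCube (Fin J), mtr k v ∈ Set.Ioo 0 Ybar
  mtr_condExp : ∀ k, P[Y k | MeasurableSpace.comap V inferInstance] =ᵐ[P] fun ω => mtr k (V ω)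
  ranked : ∀ k k', k < k' → P[Y k | MeasurableSpace.comap V inferInstance] ≤ᵐ[P]
    P[Y k' | MeasurableSpace.comap V inferInstance]

/-! ### Conditional marginal treatment responses and the identified set -/

/-- The point `v` with coordinates `x` in `l` and coordinates `y` outside `l`. -/
def glue {J : ℕ} (l : Finset (Fin J)) (x : {j // j ∈ l} → ℝ) (y : {j // j ∉ l} → ℝ) :
    Fin J → ℝ :=
  fun j => if h : j ∈ l then x ⟨j, h⟩ else y ⟨j, h⟩

/-- The marginal density of the coordinates in `l`. -/
noncomputable def marginalDensity {J : ℕ} (f : (Fin J → ℝ) → ℝ) (l : Finset (Fin J))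
    (x : {j // j ∈ l} → ℝ) : ℝ :=
  ∫ y in openCube {j // j ∉ l}, f (glue l x y)

/-- The average of `g` over the coordinates outside `l`, under their conditional density given
that the coordinates in `l` equal `x`. -/
noncomputable def condMean {J : ℕ} (f g : (Fin J → ℝ) → ℝ) (l : Finset (Fin J))
    (x : {j // j ∈ l} → ℝ) : ℝ :=
  ∫ y in openCube {j // j ∉ l}, g (glue l x y) * (f (glue l x y) / marginalDensity f l x)

section
variable {J T W : ℕ} {Ω : Type*} [MeasurableSpace Ω] {P : Measure Ω}

/-- The identified set of the response to the single treatment `k` when treatment is assigned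
by `A`: admissible functions `g` that reproduce the conditional responses of treatment `k` at its
leading terms and respect the ranking with the conditional responses of the other treatments at
their leading terms. -/
def identifiedSingle (pop : Population J T W P) (A : Mechanism J T) (k : Fin T) :
    Set ((Fin J → ℝ) → ℝ) :=
  {g | ContinuousOn g (openCube (Fin J)) ∧
    (∀ v ∈ openCube (Fin J), g v ∈ Set.Ioo 0 pop.Ybar) ∧
    (∀ l, A.IsLeading k l → ∀ᵐ x ∂(volume.restrict (openCube {j // j ∈ l})),
      condMean pop.fV (pop.mtr k) l x = condMean pop.fV g l x) ∧
    (∀ k', k' < k → ∀ l, A.IsLeading k' l → ∀ᵐ x ∂(volume.restrict (openCube {j // j ∈ l})),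
      condMean pop.fV (pop.mtr k') l x ≤ condMean pop.fV g l x) ∧
    (∀ k', k < k' → ∀ l, A.IsLeading k' l → ∀ᵐ x ∂(volume.restrict (openCube {j // j ∈ l})),
      condMean pop.fV g l x ≤ condMean pop.fV (pop.mtr k') l x)}

/-- The joint identified set of the responses to the treatments in `K`. Only the components
`m k` with `k ∈ K` are constrained. -/
def identifiedSet (pop : Population J T W P) (A : Mechanism J T) (K : Finset (Fin T)) :
    Set (Fin T → (Fin J → ℝ) → ℝ) :=
  {m | (∀ k ∈ K, m k ∈ identifiedSingle pop A k) ∧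
    ∀ k ∈ K, ∀ k' ∈ K, k < k' → ∀ᵐ v ∂(P.map pop.V), m k v ≤ m k' v}

end

/-! ### The gross policy relevant treatment effect -/

/-- The gross policy relevant treatment effect of the change from mechanism `A` with thresholds
`q o` to mechanism `A'` with thresholds `q' o` for observation `o`, with welfare weights `w`,
when the marginal treatment responses are `m`. -/
noncomputable def gprte {J T N : ℕ} (f : (Fin J → ℝ) → ℝ) (A A' : Mechanism J T)
    (q q' : Fin N → Fin J → ℝ) (w : Fin N → ℝ) (m : Fin T → (Fin J → ℝ) → ℝ) : ℝ :=
  ∑ o, w o * ∑ k, ∫ v in openCube (Fin J), (A'.d k v (q' o) - A.d k v (q o)) * m k v * f v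

/-- The effect of the change of assignment at heterogeneity `v`, that is,
`E[Y_{d'(v,q')} | V = v] - E[Y_{d(v,q)} | V = v]` when the responses are `m`. -/
noncomputable def effectAt {J T : ℕ} (A A' : Mechanism J T) (q q' : Fin J → ℝ)
    (m : Fin T → (Fin J → ℝ) → ℝ) (v : Fin J → ℝ) : ℝ :=
  ∑ k, (A'.d k v q' - A.d k v q) * m k v

/-- The lower bound of the effect at `v` over a set `I` of response families. -/
noncomputable def lowerDelta {J T : ℕ} (A A' : Mechanism J T)
    (I : Set (Fin T → (Fin J → ℝ) → ℝ)) (q q' : Fin J → ℝ) (v : Fin J → ℝ) : ℝ :=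
  ⨅ m : I, effectAt A A' q q' m v

/-- The upper bound of the effect at `v` over a set `I` of response families. -/
noncomputable def upperDelta {J T : ℕ} (A A' : Mechanism J T)
    (I : Set (Fin T → (Fin J → ℝ) → ℝ)) (q q' : Fin J → ℝ) (v : Fin J → ℝ) : ℝ :=
  ⨆ m : I, effectAt A A' q q' m v

/-! ### The simulated confidence interval -/

/-- The mean of the first `M` values of `a`. -/
noncomputable def sampleMean (M : ℕ) (a : ℕ → ℝ) : ℝ :=
  (∑ i ∈ Finset.range M, a i) / M

/-- The unbiased sample variance of the first `M` values of `a`. -/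
noncomputable def sampleVar (M : ℕ) (a : ℕ → ℝ) : ℝ :=
  (∑ i ∈ Finset.range M, (a i - sampleMean M a) ^ 2) / ((M : ℝ) - 1)

/-- The weighted sum over the observations of the means of `M` simulated values. -/
noncomputable def aggMean {N : ℕ} (w : Fin N → ℝ) (M : ℕ) (a : Fin N → ℕ → ℝ) : ℝ :=
  ∑ o, w o * sampleMean M (a o)

/-- The estimated standard deviation of `√M` times the weighted sum of the means. -/
noncomputable def aggSd {N : ℕ} (w : Fin N → ℝ) (M : ℕ) (a : Fin N → ℕ → ℝ) : ℝ :=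
  √(∑ o, w o ^ 2 * sampleVar M (a o))

/-- The standard normal distribution function. -/
noncomputable def stdNormalCDF (x : ℝ) : ℝ := cdf (gaussianReal 0 1) x

/-- `c` is the critical value at level `α` for `M` simulated lower values `a` and upper
values `b`. -/
def IsCriticalValue {N : ℕ} (α : ℝ) (w : Fin N → ℝ) (M : ℕ) (a b : Fin N → ℕ → ℝ)
    (c : ℝ) : Prop :=
  stdNormalCDF (c + √(M : ℝ) * ((aggMean w M b - aggMean w M a) /
      max (aggSd w M a) (aggSd w M b))) - stdNormalCDF (-c) = 1 - α

/-- The confidence interval with critical value `c` from `M` simulated lower values `a` and upper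
values `b`. -/
noncomputable def confInterval {N : ℕ} (w : Fin N → ℝ) (M : ℕ) (a b : Fin N → ℕ → ℝ)
    (c : ℝ) : Set ℝ :=
  Set.Icc (aggMean w M a - c * aggSd w M a / √(M : ℝ))
    (aggMean w M b + c * aggSd w M b / √(M : ℝ))

end HyperRect

open HyperRect

/-!
The simulated bounds are weighted sums of sample means of independent draws of the pointwise lower
and upper effects `δ_lo ≤ δ_up`. Both are bounded, and measurable on the cube although they are
extrema over an uncountable family of responses: on each cell where the threshold indicators are
constant the effect is continuous in `v` for every response family, so the infimum is upper
semicontinuous (`measurable_indicator_lowerDelta`; the upper effect is minus the lower effect of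
the reversed policy).

The true responses lie in the identified set because the almost sure ranking survives averaging
over the remaining coordinates, by Fubini's theorem (`Population.condMean_mono`). The identified set
is convex and the treatment effect is affine on it, so the identified set of the effect is an
interval; integrating the pointwise bounds gives the outer bounds `L ≤ U`.

For the coverage (`exists_tendsto_iInf_coverage`), let `σ_lo` and `σ_up` be the asymptotic standard
deviations of the two estimated endpoints.
* If both vanish, the simulated interval is almost surely exactly `[L, U]`, and coverage is `1`.
* If `L = U` and they do not both vanish, the two simulated families agree almost surely, the
  critical value is the constant two-sided quantile, and the coverage of the only parameter
  converges to `1 - α` by the central limit theorem and Slutsky's theorem.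
* If `L < U`, the standardized distance of the endpoints diverges, so the critical values converge
  to the one-sided quantile (`tendsto_criticalValue_atTop`). A given parameter can be missed, up to
  vanishing probability, on at most one side. Hence the worst coverage is squeezed between
  Bonferroni bounds (`le_iInf_coverage`) and the one-sided coverages of the infimum and of the
  supremum of the effects (`iInf_coverage_le_left`, `iInf_coverage_le_right`). The one-sided coverage of the infimum
  converges to `1 - α` if the infimum is `L` and `σ_lo > 0`, and to `1` otherwise
  (`exists_tendsto_lower_coverage`); likewise for the supremum.
-/

namespace HyperRect

open Filter Set
open scoped Topology

/-! ### The standard normal distribution function and the critical value -/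

lemma stdNormalCDF_eq_real (x : ℝ) : stdNormalCDF x = (gaussianReal 0 1).real (Iic x) :=
  cdf_eq_real _ x

lemma gaussianReal_measure_singleton {v : NNReal} (hv : v ≠ 0) (x : ℝ) :
    gaussianReal 0 v {x} = 0 :=
  gaussianReal_absolutelyContinuous 0 hv Real.volume_singleton

/-- Symmetry of the normal law, which has no atoms. -/
lemma stdNormalCDF_neg (x : ℝ) : stdNormalCDF (-x) = 1 - stdNormalCDF x := by
  have h : gaussianReal 0 1 (Iic (-x)) = gaussianReal 0 1 (Ioi x) := by
    conv_lhs => rw [← neg_zero, ← gaussianReal_map_neg,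
      Measure.map_apply measurable_neg measurableSet_Iic]
    have : (fun y : ℝ => -y) ⁻¹' Iic (-x) = Ioi x ∪ {x} := by
      ext y; simp [le_iff_lt_or_eq]
    rw [this]
    refine le_antisymm ((measure_union_le _ _).trans ?_) (measure_mono subset_union_left)
    simp [gaussianReal_measure_singleton one_ne_zero x]
  rw [stdNormalCDF_eq_real, stdNormalCDF_eq_real, measureReal_def, h, ← measureReal_def,
    ← compl_Iic, probReal_compl_eq_one_sub measurableSet_Iic]

lemma strictMono_stdNormalCDF : StrictMono stdNormalCDF := by
  intro x y hxy
  have hpos : 0 < (gaussianReal 0 1).real (Ioc x y) := by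
    refine ENNReal.toReal_pos (fun h => ?_) (measure_ne_top _ _)
    have := gaussianReal_absolutelyContinuous' 0 one_ne_zero h
    simp only [Real.volume_Ioc, ENNReal.ofReal_eq_zero] at this
    linarith
  have : (gaussianReal 0 1).real (Iic y)
      = (gaussianReal 0 1).real (Iic x) + (gaussianReal 0 1).real (Ioc x y) := by
    rw [← measureReal_union ?_ measurableSet_Ioc, Iic_union_Ioc_eq_Iic hxy.le]
    exact Set.disjoint_left.2 fun a ha hb => absurd hb.1 (not_lt.2 ha)
  rw [stdNormalCDF_eq_real, stdNormalCDF_eq_real]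
  linarith

lemma continuous_stdNormalCDF : Continuous stdNormalCDF := by
  have hm : Monotone (cdf (gaussianReal 0 1)) := monotone_cdf _
  refine continuous_iff_continuousAt.2 fun x => ?_
  refine (hm.continuousAt_iff_leftLim_eq_rightLim).2 ?_
  rw [StieltjesFunction.rightLim_eq]
  have h := StieltjesFunction.measure_singleton (cdf (gaussianReal 0 1)) x
  rw [measure_cdf, gaussianReal_measure_singleton one_ne_zero] at h
  have := ENNReal.ofReal_eq_zero.1 h.symm
  exact le_antisymm (hm.leftLim_le le_rfl) (by linarith)

lemma tendsto_stdNormalCDF_atTop : Tendsto stdNormalCDF atTop (𝓝 1) := tendsto_cdf_atTop _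

lemma tendsto_stdNormalCDF_atBot : Tendsto stdNormalCDF atBot (𝓝 0) := tendsto_cdf_atBot _

/-- The defining equation of the critical value is strictly increasing in `c`, so its solution is
unique. -/
lemma strictMono_coverage (t : ℝ) :
    StrictMono fun c : ℝ => stdNormalCDF (c + t) - stdNormalCDF (-c) := fun x y h => by
  have h1 := strictMono_stdNormalCDF (add_lt_add_left h t)
  have h2 := strictMono_stdNormalCDF (neg_lt_neg h)
  simp only [] at h1 ⊢
  linarith

lemma exists_critical {α : ℝ} (hα : 0 < α) (hα' : α < 1) (t : ℝ) :
    ∃ c : ℝ, stdNormalCDF (c + t) - stdNormalCDF (-c) = 1 - α := by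
  have hc : Continuous fun c : ℝ => stdNormalCDF (c + t) - stdNormalCDF (-c) :=
    (continuous_stdNormalCDF.comp (by fun_prop)).sub (continuous_stdNormalCDF.comp (by fun_prop))
  have h1 : Tendsto (fun c : ℝ => stdNormalCDF (c + t) - stdNormalCDF (-c)) atTop (𝓝 (1 - 0)) :=
    (tendsto_stdNormalCDF_atTop.comp (tendsto_atTop_add_const_right _ t tendsto_id)).sub
      (tendsto_stdNormalCDF_atBot.comp tendsto_neg_atTop_atBot)
  have h2 : Tendsto (fun c : ℝ => stdNormalCDF (c + t) - stdNormalCDF (-c)) atBot (𝓝 (0 - 1)) :=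
    (tendsto_stdNormalCDF_atBot.comp (tendsto_atBot_add_const_right _ t tendsto_id)).sub
      (tendsto_stdNormalCDF_atTop.comp tendsto_neg_atBot_atTop)
  refine mem_range_of_exists_le_of_exists_ge hc ?_ ?_
  · exact ((h2.eventually_lt_const (u := 1 - α) (by linarith)).exists).imp fun _ h => h.le
  · exact ((h1.eventually_const_lt (u := 1 - α) (by linarith)).exists).imp fun _ h => h.le

lemma exists_stdNormalCDF_eq {p : ℝ} (h0 : 0 < p) (h1 : p < 1) : ∃ z, stdNormalCDF z = p := by
  refine mem_range_of_exists_le_of_exists_ge continuous_stdNormalCDF ?_ ?_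
  · exact ((tendsto_stdNormalCDF_atBot.eventually_lt_const h0).exists).imp fun _ h => h.le
  · exact ((tendsto_stdNormalCDF_atTop.eventually_const_lt h1).exists).imp fun _ h => h.le

open Classical in
/-- The critical value as a function of the standardized distance `t` between the two estimated
endpoints: the solution `c` of `Φ(c + t) - Φ(-c) = 1 - α`, with the value `0` where there is
none (which does not happen for `α ∈ (0,1)`). -/
noncomputable def criticalValue (α t : ℝ) : ℝ :=
  if h : ∃ c : ℝ, stdNormalCDF (c + t) - stdNormalCDF (-c) = 1 - α then h.choose else 0

lemma criticalValue_spec {α : ℝ} (hα : 0 < α) (hα' : α < 1) (t : ℝ) :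
    stdNormalCDF (criticalValue α t + t) - stdNormalCDF (-criticalValue α t) = 1 - α := by
  have h := exists_critical hα hα' t
  rw [criticalValue, dif_pos h]
  exact h.choose_spec

lemma eq_criticalValue {α c t : ℝ} (hα : 0 < α) (hα' : α < 1)
    (h : stdNormalCDF (c + t) - stdNormalCDF (-c) = 1 - α) : c = criticalValue α t :=
  (strictMono_coverage t).injective (h.trans (criticalValue_spec hα hα' t).symm)

/-- Critical values decrease in the standardized distance of the endpoints; in particular they
depend measurably on it. -/
lemma antitone_criticalValue {α : ℝ} (hα : 0 < α) (hα' : α < 1) :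
    Antitone (criticalValue α) := by
  intro s t hst
  by_contra! hlt
  have h1 := strictMono_coverage t hlt
  have h2 := criticalValue_spec hα hα' s
  have h3 := criticalValue_spec hα hα' t
  have h4 := strictMono_stdNormalCDF.monotone (add_le_add_right hst (criticalValue α s))
  simp only [] at h1 h4
  linarith

/-- When the estimated endpoints are far apart in standard errors, the critical value is the
one-sided one. -/
lemma tendsto_criticalValue_atTop {α z : ℝ} (hα : 0 < α) (hα' : α < 1)
    (hz : stdNormalCDF z = 1 - α) : Tendsto (criticalValue α) atTop (𝓝 z) := by
  have hlim : ∀ c : ℝ, Tendsto (fun t => stdNormalCDF (c + t) - stdNormalCDF (-c)) atTop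
      (𝓝 (stdNormalCDF c)) := fun c => by
    have h := (tendsto_stdNormalCDF_atTop.comp (tendsto_atTop_add_const_left _ c tendsto_id)).sub
      (tendsto_const_nhds (x := stdNormalCDF (-c)))
    have e : (1 : ℝ) - stdNormalCDF (-c) = stdNormalCDF c := by rw [stdNormalCDF_neg]; ring
    rwa [e] at h
  refine tendsto_order.2 ⟨fun c hc => ?_, fun c hc => ?_⟩
  · have := strictMono_stdNormalCDF hc
    rw [hz] at this
    filter_upwards [(hlim c).eventually_lt_const this] with t ht
    rw [← criticalValue_spec hα hα' t] at ht
    exact (strictMono_coverage t).lt_iff_lt.1 ht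
  · have := strictMono_stdNormalCDF hc
    rw [hz] at this
    filter_upwards [(hlim c).eventually_const_lt this] with t ht
    rw [← criticalValue_spec hα hα' t] at ht
    exact (strictMono_coverage t).lt_iff_lt.1 ht

lemma gaussianReal_real_Iic_mul {σ : ℝ} (hσ : 0 < σ) (z : ℝ) :
    (gaussianReal 0 (σ ^ 2).toNNReal).real (Iic (z * σ)) = stdNormalCDF z := by
  have h : gaussianReal 0 (σ ^ 2).toNNReal = (gaussianReal 0 1).map (σ * ·) := by
    rw [gaussianReal_map_const_mul]
    congr 1
    · simp
    · ext; simp [Real.coe_toNNReal _ (sq_nonneg σ)]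
  rw [h, map_measureReal_apply (by fun_prop) measurableSet_Iic, stdNormalCDF_eq_real]
  congr 1
  ext y
  simp only [mem_preimage, mem_Iic]
  rw [mul_comm z, mul_le_mul_iff_right₀ hσ]

lemma gaussianReal_real_abs_le {σ : ℝ} (hσ : 0 < σ) {c : ℝ} (hc : 0 ≤ c) :
    (gaussianReal 0 (σ ^ 2).toNNReal).real {x | |x| ≤ c * σ}
      = stdNormalCDF c - stdNormalCDF (-c) := by
  have hv : (σ ^ 2).toNNReal ≠ 0 := by simp [hσ.ne']
  rw [← gaussianReal_real_Iic_mul hσ, ← gaussianReal_real_Iic_mul hσ]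
  have hle : -c * σ ≤ c * σ := by nlinarith
  have e1 : {x : ℝ | |x| ≤ c * σ} = {-c * σ} ∪ Ioc (-c * σ) (c * σ) := by
    rw [singleton_union, Set.insert_eq, singleton_union, Ioc_insert_left hle]
    ext x; simp [abs_le]
  have h2 : (gaussianReal 0 (σ ^ 2).toNNReal).real {-c * σ} = 0 := by
    simp [measureReal_def, gaussianReal_measure_singleton hv]
  rw [e1, measureReal_union (by simp) measurableSet_Ioc, h2, zero_add,
    ← Iic_union_Ioc_eq_Iic hle, measureReal_union (Iic_disjoint_Ioc le_rfl) measurableSet_Ioc]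
  ring

/-! ### Sample means and variances along a sequence -/

lemma aggMean_eq {N : ℕ} (w : Fin N → ℝ) (M : ℕ) (a : Fin N → ℕ → ℝ) :
    aggMean w M a = (∑ i ∈ Finset.range M, ∑ o, w o * a o i) / M := by
  simp only [aggMean, sampleMean]
  rw [Finset.sum_comm, Finset.sum_div]
  refine Finset.sum_congr rfl fun o _ => ?_
  rw [← Finset.mul_sum, mul_div_assoc]

lemma aggMean_neg {N : ℕ} (w : Fin N → ℝ) (M : ℕ) (a : Fin N → ℕ → ℝ) :
    aggMean w M (fun o i => -a o i) = -aggMean w M a := by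
  simp [aggMean, sampleMean, Finset.sum_neg_distrib, neg_div]

lemma sampleVar_neg (M : ℕ) (a : ℕ → ℝ) : sampleVar M (fun i => -a i) = sampleVar M a := by
  have : sampleMean M (fun i => -a i) = -sampleMean M a := by
    simp [sampleMean, Finset.sum_neg_distrib, neg_div]
  simp only [sampleVar, this]
  congr 1
  exact Finset.sum_congr rfl fun i _ => by ring

lemma aggSd_neg {N : ℕ} (w : Fin N → ℝ) (M : ℕ) (a : Fin N → ℕ → ℝ) :
    aggSd w M (fun o i => -a o i) = aggSd w M a := by
  simp only [aggSd, sampleVar_neg]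

lemma sampleVar_eq {M : ℕ} (hM : M ≠ 0) (a : ℕ → ℝ) :
    sampleVar M a = (sampleMean M (fun i => a i ^ 2) - sampleMean M a ^ 2)
      * (M / ((M : ℝ) - 1)) := by
  have hM' : (M : ℝ) ≠ 0 := Nat.cast_ne_zero.2 hM
  have h : ∑ i ∈ Finset.range M, (a i - sampleMean M a) ^ 2
      = M * (sampleMean M (fun i => a i ^ 2) - sampleMean M a ^ 2) := by
    have h1 : ∑ i ∈ Finset.range M, a i = M * sampleMean M a := by
      rw [sampleMean]; field_simp
    have h2 : ∑ i ∈ Finset.range M, a i ^ 2 = M * sampleMean M (fun i => a i ^ 2) := by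
      rw [sampleMean]; field_simp
    have h3 : ∀ i, (a i - sampleMean M a) ^ 2
        = a i ^ 2 - 2 * sampleMean M a * a i + sampleMean M a ^ 2 := fun i => by ring
    simp only [h3, Finset.sum_add_distrib, Finset.sum_sub_distrib, ← Finset.mul_sum, h1, h2]
    simp
    ring
  rw [sampleVar, h]
  ring

lemma tendsto_sampleVar {a : ℕ → ℝ} {m s : ℝ}
    (hm : Tendsto (fun M => sampleMean M a) atTop (𝓝 m))
    (hs : Tendsto (fun M => sampleMean M fun i => a i ^ 2) atTop (𝓝 s)) :
    Tendsto (fun M => sampleVar M a) atTop (𝓝 (s - m ^ 2)) := by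
  have h1 : Tendsto (fun M : ℕ => (M : ℝ) / ((M : ℝ) - 1)) atTop (𝓝 1) := by
    have h := tendsto_natCast_div_add_atTop (-1 : ℝ)
    simpa [sub_eq_add_neg] using h
  have h2 := (hs.sub (hm.pow 2)).mul h1
  rw [mul_one] at h2
  refine h2.congr' ?_
  filter_upwards [eventually_ne_atTop 0] with M hM
  exact (sampleVar_eq hM a).symm

/-! ### Simulated draws: laws of large numbers and the central limit theorem -/

/-- Grouping an independent family indexed by pairs along the second index yields an independent
family of tuples. -/
lemma iIndepFun_curry {Ω ι κ E : Type*} [MeasurableSpace Ω] [MeasurableSpace E]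
    {μ : Measure Ω} {X : κ × ι → Ω → E} (mX : ∀ p, Measurable (X p)) (h : iIndepFun X μ) :
    iIndepFun (fun (i : ι) ω (o : κ) => X (o, i) ω) μ := by
  have := h.isProbabilityMeasure
  have hP : ∀ i o, IsProbabilityMeasure (μ.map (X (o, i))) :=
    fun i o => Measure.isProbabilityMeasure_map (mX _).aemeasurable
  have h1 : iIndepFun (fun (p : (_ : ι) × κ) ω => X (p.2, p.1) ω) μ :=
    h.precomp (g := fun p : (_ : ι) × κ => (p.2, p.1)) (by
      rintro ⟨i, o⟩ ⟨i', o'⟩ h; simp only [Prod.mk.injEq] at h; obtain ⟨rfl, rfl⟩ := h; rfl)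
  have e : (MeasurableEquiv.piCurry fun (_ : ι) (_ : κ) => E)
      ∘ (fun ω (p : (_ : ι) × κ) => X (p.2, p.1) ω) = fun ω i o => X (o, i) ω := by
    ext; simp [Sigma.curry]
  rw [iIndepFun_iff_map_fun_eq_infinitePi_map (by fun_prop), ← e,
    ← Measure.map_map (by fun_prop) (by fun_prop),
    (iIndepFun_iff_map_fun_eq_infinitePi_map (by fun_prop)).1 h1,
    Measure.infinitePi_map_piCurry (fun i o => μ.map (X (o, i)))]
  congrm Measure.infinitePi fun i => ?_
  have h2 : iIndepFun (fun (o : κ) => X (o, i)) μ :=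
    h.precomp (g := fun o : κ => (o, i)) fun a b h => (Prod.mk.inj h).1
  rw [(iIndepFun_iff_map_fun_eq_infinitePi_map (by fun_prop)).1 h2]

/-- The weighted sum of the means of the functions `a o` under `ν`. -/
noncomputable def popMean {E : Type*} [MeasurableSpace E] {N : ℕ} (ν : Measure E) (w : Fin N → ℝ)
    (a : Fin N → E → ℝ) : ℝ :=
  ∑ o, w o * ∫ x, a o x ∂ν

/-- The weighted sum, with squared weights, of the variances of the functions `a o` under `ν`: the
variance of the weighted sum of independent draws, one for each `o`. -/
noncomputable def popVar {E : Type*} [MeasurableSpace E] {N : ℕ} (ν : Measure E) (w : Fin N → ℝ)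
    (a : Fin N → E → ℝ) : ℝ :=
  ∑ o, w o ^ 2 * Var[a o; ν]

section draws

variable {E Ω : Type*} [MeasurableSpace E] [MeasurableSpace Ω] {N : ℕ}
  {ν : Measure E} {μ : Measure Ω} {ξ : Fin N × ℕ → Ω → E} {w : Fin N → ℝ} {a : Fin N → E → ℝ}

lemma popVar_nonneg : 0 ≤ popVar ν w a :=
  Finset.sum_nonneg fun _ _ => mul_nonneg (sq_nonneg _) (variance_nonneg _ _)

lemma measurable_aggMean (hξ : ∀ p, Measurable (ξ p)) (ha : ∀ o, Measurable (a o)) (M : ℕ) :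
    Measurable fun ω => aggMean w M fun o i => a o (ξ (o, i) ω) := by
  unfold aggMean sampleMean
  fun_prop

lemma measurable_aggSd (hξ : ∀ p, Measurable (ξ p)) (ha : ∀ o, Measurable (a o)) (M : ℕ) :
    Measurable fun ω => aggSd w M fun o i => a o (ξ (o, i) ω) := by
  unfold aggSd sampleVar sampleMean
  fun_prop

lemma identDistrib_draw (hξ : ∀ p, Measurable (ξ p)) (hlaw : ∀ p, μ.map (ξ p) = ν)
    (p q : Fin N × ℕ) : IdentDistrib (ξ p) (ξ q) μ μ :=
  ⟨(hξ p).aemeasurable, (hξ q).aemeasurable, (hlaw p).trans (hlaw q).symm⟩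

lemma integral_comp_draw (hξ : ∀ p, Measurable (ξ p)) (hlaw : ∀ p, μ.map (ξ p) = ν)
    {g : E → ℝ} (hg : Measurable g) (p : Fin N × ℕ) :
    ∫ ω, g (ξ p ω) ∂μ = ∫ x, g x ∂ν := by
  rw [← hlaw p, integral_map (hξ p).aemeasurable hg.aestronglyMeasurable]

variable [IsProbabilityMeasure μ]

lemma isProbabilityMeasure_of_map [NeZero N] (hξ : ∀ p, Measurable (ξ p))
    (hlaw : ∀ p, μ.map (ξ p) = ν) : IsProbabilityMeasure ν :=
  hlaw (0, 0) ▸ Measure.isProbabilityMeasure_map (hξ _).aemeasurable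

lemma memLp_comp_draw (hξ : ∀ p, Measurable (ξ p)) {g : E → ℝ} (hg : Measurable g) {B : ℝ}
    (hB : ∀ x, |g x| ≤ B) (p : Fin N × ℕ) : MemLp (fun ω => g (ξ p ω)) 2 μ :=
  MemLp.of_bound (hg.comp (hξ p)).aestronglyMeasurable B (ae_of_all _ fun _ => hB _)

/-- The strong law of large numbers for the draws with index `o`. -/
lemma ae_tendsto_sampleMean (hξ : ∀ p, Measurable (ξ p)) (hlaw : ∀ p, μ.map (ξ p) = ν)
    (hind : iIndepFun ξ μ) {g : E → ℝ} (hg : Measurable g) {B : ℝ} (hB : ∀ x, |g x| ≤ B)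
    (o : Fin N) :
    ∀ᵐ ω ∂μ, Tendsto (fun M => sampleMean M fun i => g (ξ (o, i) ω)) atTop
      (𝓝 (∫ x, g x ∂ν)) := by
  have h := strong_law_ae_real (μ := μ) (fun i ω => g (ξ (o, i) ω))
    ((memLp_comp_draw hξ hg hB (o, 0)).integrable (by norm_num))
    (fun i j hij => (hind.indepFun (i := (o, i)) (j := (o, j))
      fun h => hij (Prod.mk.inj h).2).comp hg hg)
    (fun i => (identDistrib_draw hξ hlaw (o, i) (o, 0)).comp hg)
  rw [integral_comp_draw hξ hlaw hg] at h
  exact h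

lemma ae_tendsto_aggMean (hξ : ∀ p, Measurable (ξ p)) (hlaw : ∀ p, μ.map (ξ p) = ν)
    (hind : iIndepFun ξ μ) (ha : ∀ o, Measurable (a o)) {B : ℝ} (hB : ∀ o x, |a o x| ≤ B) :
    ∀ᵐ ω ∂μ, Tendsto (fun M => aggMean w M fun o i => a o (ξ (o, i) ω)) atTop
      (𝓝 (popMean ν w a)) := by
  filter_upwards [ae_all_iff.2 fun o => ae_tendsto_sampleMean hξ hlaw hind (ha o) (hB o) o]
    with ω hω
  exact tendsto_finsetSum _ fun o _ => (hω o).const_mul _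

lemma ae_tendsto_aggSd (hξ : ∀ p, Measurable (ξ p)) (hlaw : ∀ p, μ.map (ξ p) = ν)
    (hind : iIndepFun ξ μ) (ha : ∀ o, Measurable (a o)) {B : ℝ} (hB : ∀ o x, |a o x| ≤ B) :
    ∀ᵐ ω ∂μ, Tendsto (fun M => aggSd w M fun o i => a o (ξ (o, i) ω)) atTop
      (𝓝 (√(popVar ν w a))) := by
  have hB2 : ∀ o x, |a o x ^ 2| ≤ B ^ 2 := fun o x => by
    rw [abs_pow]; exact pow_le_pow_left₀ (abs_nonneg _) (hB o x) 2
  filter_upwards [ae_all_iff.2 fun o => ae_tendsto_sampleMean hξ hlaw hind (ha o) (hB o) o,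
    ae_all_iff.2 fun o => ae_tendsto_sampleMean hξ hlaw hind ((ha o).pow_const 2) (hB2 o) o]
    with ω hω hω2
  refine (Real.continuous_sqrt.tendsto _).comp ?_
  refine tendsto_finsetSum _ fun o _ => ?_
  have : NeZero N := ⟨fun h => by subst h; exact o.elim0⟩
  have := isProbabilityMeasure_of_map hξ hlaw
  have hv : Var[a o; ν] = ∫ x, a o x ^ 2 ∂ν - (∫ x, a o x ∂ν) ^ 2 :=
    variance_eq_sub (MemLp.of_bound (ha o).aestronglyMeasurable B (ae_of_all _ (hB o)))
  rw [hv]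
  exact (tendsto_sampleVar (hω o) (hω2 o)).const_mul _

/-- The central limit theorem for the weighted sum of simulated means. -/
lemma tendstoInDistribution_aggMean (hξ : ∀ p, Measurable (ξ p)) (hlaw : ∀ p, μ.map (ξ p) = ν)
    (hind : iIndepFun ξ μ) (ha : ∀ o, Measurable (a o)) {B : ℝ} (hB : ∀ o x, |a o x| ≤ B) :
    TendstoInDistribution
      (fun (M : ℕ) ω => √(M : ℝ) * ((aggMean w M fun o i => a o (ξ (o, i) ω)) - popMean ν w a))
      atTop id (fun _ => μ) (gaussianReal 0 (popVar ν w a).toNNReal) := by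
  set S : ℕ → Ω → ℝ := fun i ω => ∑ o, w o * a o (ξ (o, i) ω) with hS
  have hg : Measurable fun y : Fin N → E => ∑ o, w o * a o (y o) := by fun_prop
  have hcur := iIndepFun_curry hξ hind
  have hindS : iIndepFun S μ := hcur.comp (fun _ y => ∑ o, w o * a o (y o)) fun _ => hg
  have hLp : ∀ o, MemLp (fun ω => w o * a o (ξ (o, 0) ω)) 2 μ := fun o =>
    (memLp_comp_draw hξ (ha o) (hB o) (o, 0)).const_mul _
  have hmean : μ[S 0] = popMean ν w a := by
    simp only [hS]
    rw [integral_finsetSum _ fun o _ => (hLp o).integrable (by norm_num)]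
    exact Finset.sum_congr rfl fun o _ => by
      rw [integral_const_mul, integral_comp_draw hξ hlaw (ha o)]
  have hvar : Var[S 0; μ] = popVar ν w a := by
    have e : S 0 = ∑ o, fun ω => w o * a o (ξ (o, 0) ω) := by
      ext ω; simp [hS]
    rw [e, IndepFun.variance_sum fun o _ => hLp o]
    · refine Finset.sum_congr rfl fun o _ => ?_
      rw [variance_const_mul, ← hlaw (o, 0), variance_map (ha o).aemeasurable
        (hξ _).aemeasurable]
      rfl
    · intro o _ o' _ hne
      exact (hind.indepFun (i := (o, 0)) (j := (o', 0)) fun h => hne (Prod.mk.inj h).1).comp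
        ((ha o).const_mul (w o)) ((ha o').const_mul (w o'))
  have hident : ∀ i, IdentDistrib (S i) (S 0) μ μ := by
    intro i
    have hm : ∀ i, Measurable fun ω (o : Fin N) => ξ (o, i) ω := fun i => by fun_prop
    have hmap : ∀ i, μ.map (fun ω (o : Fin N) => ξ (o, i) ω) = Measure.pi fun _ => ν := by
      intro i
      have h2 : iIndepFun (fun o : Fin N => ξ (o, i)) μ :=
        hind.precomp (g := fun o : Fin N => (o, i)) fun a b h => (Prod.mk.inj h).1
      rw [h2.map_fun_eq_pi_map fun o => (hξ _).aemeasurable]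
      simp only [hlaw]
    exact IdentDistrib.comp (u := fun y : Fin N → E => ∑ o, w o * a o (y o))
      ⟨(hm i).aemeasurable, (hm 0).aemeasurable, (hmap i).trans (hmap 0).symm⟩ hg
  have hS2 : MemLp (S 0) 2 μ := by
    have := memLp_finsetSum Finset.univ fun o _ => hLp o
    exact this
  have key := tendstoInDistribution_inv_sqrt_mul_sum_sub (P := μ) (X := S)
    (P' := gaussianReal 0 Var[S 0; μ].toNNReal) (Y := id) HasLaw.id hS2 hindS hident
  simp only [hmean] at key
  rw [← hvar]
  convert key using 3 with M ω
  rw [aggMean_eq]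
  rcases eq_or_ne M 0 with rfl | hM
  · simp
  have hM' : (0 : ℝ) < M := by exact_mod_cast Nat.pos_of_ne_zero hM
  have hs := Real.mul_self_sqrt hM'.le
  have hs' : √(M : ℝ) ≠ 0 := (Real.sqrt_pos.2 hM').ne'
  rw [eq_inv_mul_iff_mul_eq₀ hs', ← mul_assoc, hs]
  field_simp
  rfl

/-- Slutsky's theorem and the portmanteau theorem, combined for events `g (X n, κ n) ≤ 0` whose
limiting boundary event `g (·, k) = 0` has probability zero. -/
lemma tendsto_measureReal_le_zero {γ : Measure ℝ} [IsProbabilityMeasure γ] {X κ : ℕ → Ω → ℝ}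
    {k : ℝ} (hX : TendstoInDistribution X atTop id (fun _ => μ) γ)
    (hκm : ∀ n, AEMeasurable (κ n) μ) (hκ : ∀ᵐ ω ∂μ, Tendsto (fun n => κ n ω) atTop (𝓝 k))
    {g : ℝ × ℝ → ℝ} (hg : Continuous g) (h0 : γ {x | g (x, k) = 0} = 0) :
    Tendsto (fun n => μ.real {ω | g (X n ω, κ n ω) ≤ 0}) atTop
      (𝓝 (γ.real {x | g (x, k) ≤ 0})) := by
  have h := hX.continuous_comp_prodMk_of_tendstoInMeasure_const hg
    (tendstoInMeasure_of_tendsto_ae (fun n => (hκm n).aestronglyMeasurable) hκ) hκm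
  have hm : Measurable fun x : ℝ => g (x, k) := by fun_prop
  have hp := ProbabilityMeasure.tendsto_measure_of_null_frontier_of_tendsto' h.tendsto
    (E := Iic 0) (by
      simp only [ProbabilityMeasure.coe_mk, frontier_Iic, id]
      rw [Measure.map_apply hm (measurableSet_singleton 0)]
      exact h0)
  simp only [ProbabilityMeasure.coe_mk, id] at hp
  have hpm := Measure.isProbabilityMeasure_map hm.aemeasurable (μ := γ)
  have hp' := (ENNReal.tendsto_toReal (measure_ne_top _ _)).comp hp
  simp only [Function.comp_def] at hp'
  rw [Measure.map_apply hm measurableSet_Iic] at hp'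
  refine (tendsto_congr fun n => ?_).1 hp'
  rw [Measure.map_apply_of_aemeasurable (h.forall_aemeasurable n) measurableSet_Iic]
  rfl

end draws

/-! ### Limits of coverage probabilities -/

lemma measureReal_add_sub_one_le {Ω : Type*} [MeasurableSpace Ω] {μ : Measure Ω}
    [IsProbabilityMeasure μ] {s t : Set Ω} (ht : NullMeasurableSet t μ) :
    μ.real s + μ.real t - 1 ≤ μ.real (s ∩ t) := by
  have h := measureReal_union_add_inter₀ (s := s) ht
  have h1 : μ.real (s ∪ t) ≤ 1 := measureReal_le_one
  linarith

/-- If the left endpoints converge almost surely to a point below `θ`, they are eventually below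
`θ` with probability tending to one. -/
lemma tendsto_measureReal_le_one {Ω : Type*} [MeasurableSpace Ω] {μ : Measure Ω}
    [IsProbabilityMeasure μ] {X : ℕ → Ω → ℝ} {l θ : ℝ} (hX : ∀ n, AEMeasurable (X n) μ)
    (h : ∀ᵐ ω ∂μ, Tendsto (fun n => X n ω) atTop (𝓝 l)) (hl : l < θ) :
    Tendsto (fun n => μ.real {ω | X n ω ≤ θ}) atTop (𝓝 1) := by
  have hm := tendstoInMeasure_of_tendsto_ae (fun n => (hX n).aestronglyMeasurable) h
  rw [tendstoInMeasure_iff_measureReal_dist] at hm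
  have h1 := (tendsto_const_nhds (x := (1 : ℝ))).sub (hm (θ - l) (sub_pos.2 hl))
  rw [sub_zero] at h1
  refine tendsto_of_tendsto_of_tendsto_of_le_of_le h1 tendsto_const_nhds (fun n => ?_)
    fun n => measureReal_le_one
  have hu : {ω | X n ω ≤ θ} ∪ {ω | θ - l ≤ dist (X n ω) l} = univ := by
    refine eq_univ_of_forall fun ω => ?_
    rcases le_total (X n ω) θ with h | h
    · exact Or.inl h
    · exact Or.inr ((sub_le_sub_right h l).trans (le_abs_self _))
  have := measureReal_union_le (μ := μ) {ω | X n ω ≤ θ} {ω | θ - l ≤ dist (X n ω) l}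
  rw [hu, probReal_univ] at this
  simp only [] at this ⊢
  linarith

section infimum

variable {Ω ι : Type*} [MeasurableSpace Ω] {μ : Measure Ω} [IsProbabilityMeasure μ] [Nonempty ι]
  {X Y : Ω → ℝ} {θ : ι → ℝ}

/-- The worst coverage over a set of parameters is at most the coverage of its infimum by the
lower confidence bound, even where the infimum is not attained: distribution functions are right
continuous. -/
lemma iInf_coverage_le_left (hX : AEMeasurable X μ) (hb : BddBelow (range θ)) :
    ⨅ i, μ.real {ω | X ω ≤ θ i ∧ θ i ≤ Y ω} ≤ μ.real {ω | X ω ≤ ⨅ i, θ i} := by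
  have hP := Measure.isProbabilityMeasure_map hX
  have hc : ∀ t, μ.real {ω | X ω ≤ t} = cdf (μ.map X) t := fun t => by
    rw [cdf_eq_real, measureReal_def, measureReal_def,
      Measure.map_apply_of_aemeasurable hX measurableSet_Iic]
    rfl
  rw [hc]
  by_contra! hlt
  have hr := (cdf (μ.map X)).right_continuous (⨅ i, θ i)
  obtain ⟨u, hu, hsub⟩ := (mem_nhdsGE_iff_exists_Ico_subset).1
    (hr.eventually_lt_const hlt)
  obtain ⟨i, hi⟩ := exists_lt_of_ciInf_lt (mem_Ioi.1 hu)
  have hbdd : BddBelow (range fun i => μ.real {ω | X ω ≤ θ i ∧ θ i ≤ Y ω}) :=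
    ⟨0, by rintro _ ⟨i, rfl⟩; exact measureReal_nonneg⟩
  have h1 := ciInf_le hbdd i
  have h2 : μ.real {ω | X ω ≤ θ i ∧ θ i ≤ Y ω} ≤ μ.real {ω | X ω ≤ θ i} :=
    measureReal_mono fun ω h => h.1
  rw [hc] at h2
  have h3 : cdf (μ.map X) (θ i) < _ := hsub ⟨ciInf_le hb i, hi⟩
  exact absurd (h1.trans h2) (not_le.2 h3)

lemma iInf_coverage_le_right (hY : AEMeasurable Y μ) (ha : BddAbove (range θ)) :
    ⨅ i, μ.real {ω | X ω ≤ θ i ∧ θ i ≤ Y ω} ≤ μ.real {ω | ⨆ i, θ i ≤ Y ω} := by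
  have h := iInf_coverage_le_left (X := fun ω => -Y ω) (Y := fun ω => -X ω) (θ := fun i => -θ i)
    hY.neg (by obtain ⟨u, hu⟩ := ha; exact ⟨-u, by
      rintro _ ⟨i, rfl⟩; exact neg_le_neg (hu ⟨i, rfl⟩)⟩)
  have hn : ⨅ i, -θ i = -⨆ i, θ i := ((OrderIso.neg ℝ).map_ciSup ha).symm
  rw [hn] at h
  simp only [neg_le_neg_iff] at h
  convert h using 5
  exact funext fun ω => propext and_comm

/-- A Bonferroni bound for the worst coverage: a parameter below the cut `m` can only be missed
if the lower bound exceeds the smallest parameter or the upper bound falls below `m`, and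
symmetrically above the cut. -/
lemma le_iInf_coverage (hX : AEMeasurable X μ) (hY : AEMeasurable Y μ)
    (hb : BddBelow (range θ)) (ha : BddAbove (range θ)) (m : ℝ) :
    min (μ.real {ω | X ω ≤ ⨅ i, θ i} + μ.real {ω | m ≤ Y ω} - 1)
      (μ.real {ω | ⨆ i, θ i ≤ Y ω} + μ.real {ω | X ω ≤ m} - 1)
      ≤ ⨅ i, μ.real {ω | X ω ≤ θ i ∧ θ i ≤ Y ω} := by
  refine le_ciInf fun i => ?_
  rcases le_total (θ i) m with h | h
  · refine (min_le_left _ _).trans ((measureReal_add_sub_one_le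
      (nullMeasurableSet_le aemeasurable_const hY)).trans (measureReal_mono ?_))
    exact fun ω hω => ⟨hω.1.trans (ciInf_le hb i), h.trans hω.2⟩
  · refine (min_le_right _ _).trans ((measureReal_add_sub_one_le
      (nullMeasurableSet_le hX aemeasurable_const)).trans (measureReal_mono ?_))
    exact fun ω hω => ⟨hω.2.trans h, (le_ciSup ha i).trans hω.1⟩

end infimum

section coverage

variable {E Ω : Type*} [MeasurableSpace E] [MeasurableSpace Ω] {N : ℕ}
  {ν : Measure E} {μ : Measure Ω} [IsProbabilityMeasure μ]
  {ξ : Fin N × ℕ → Ω → E} {w : Fin N → ℝ} {a b : Fin N → E → ℝ}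

lemma popMean_neg : popMean ν w (fun o x => -a o x) = -popMean ν w a := by
  simp [popMean, integral_neg, Finset.sum_neg_distrib]

/-- Without variance, the simulated means are exact and the estimated standard deviations vanish,
almost surely. -/
lemma ae_eq_of_popVar_eq_zero (hξ : ∀ p, Measurable (ξ p)) (hlaw : ∀ p, μ.map (ξ p) = ν)
    (ha : ∀ o, Measurable (a o)) {B : ℝ} (hB : ∀ o x, |a o x| ≤ B)
    (h0 : popVar ν w a = 0) :
    ∀ᵐ ω ∂μ, ∀ M : ℕ, M ≠ 0 → aggMean w M (fun o i => a o (ξ (o, i) ω)) = popMean ν w a ∧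
      aggSd w M (fun o i => a o (ξ (o, i) ω)) = 0 := by
  have hall : ∀ᵐ ω ∂μ, ∀ o i, w o = 0 ∨ a o (ξ (o, i) ω) = ∫ x, a o x ∂ν := by
    refine ae_all_iff.2 fun o => ae_all_iff.2 fun i => ?_
    have : NeZero N := ⟨fun h => by subst h; exact o.elim0⟩
    have := isProbabilityMeasure_of_map hξ hlaw
    have ho := (Finset.sum_eq_zero_iff_of_nonneg fun o _ =>
      mul_nonneg (sq_nonneg (w o)) (variance_nonneg (a o) ν)).1 h0 o (Finset.mem_univ o)
    rcases mul_eq_zero.1 ho with hw | hv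
    · exact ae_of_all _ fun ω => Or.inl (pow_eq_zero_iff two_ne_zero |>.1 hw)
    · have h1 := ae_eq_integral_of_variance_eq_zero
        (MemLp.of_bound (ha o).aestronglyMeasurable B (ae_of_all _ (hB o))) hv
      rw [← hlaw (o, i)] at h1
      filter_upwards [ae_of_ae_map (hξ _).aemeasurable h1] with ω hω
      right
      rw [hω, hlaw]
  filter_upwards [hall] with ω hω M hM
  have hM' : (M : ℝ) ≠ 0 := Nat.cast_ne_zero.2 hM
  have hmean : ∀ o, a o (ξ (o, 0) ω) = ∫ x, a o x ∂ν →
      (∀ i, a o (ξ (o, i) ω) = ∫ x, a o x ∂ν) →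
      sampleMean M (fun i => a o (ξ (o, i) ω)) = ∫ x, a o x ∂ν := fun o _ h => by
    simp only [sampleMean, h]
    simp [hM']
  constructor
  · refine Finset.sum_congr rfl fun o _ => ?_
    by_cases hw : w o = 0
    · simp [hw]
    · rw [hmean o ((hω o 0).resolve_left hw) fun i => (hω o i).resolve_left hw]
  · rw [aggSd, Finset.sum_eq_zero, Real.sqrt_zero]
    intro o _
    by_cases hw : w o = 0
    · simp [hw]
    · have hi : ∀ i, a o (ξ (o, i) ω) = ∫ x, a o x ∂ν := fun i => (hω o i).resolve_left hw
      rw [sampleVar, hmean o (hi 0) hi]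
      simp [hi]

/-- Coverage of a parameter `θ` at or above the mean by the lower confidence bound, when the
critical values converge to the one-sided normal quantile. The limit is `1` above the mean, by the
law of large numbers, and at the mean if there is no variance, since the bound is then exact; it is
`1 - α` at the mean otherwise. -/
lemma exists_tendsto_lower_coverage (hξ : ∀ p, Measurable (ξ p))
    (hlaw : ∀ p, μ.map (ξ p) = ν) (hind : iIndepFun ξ μ) (ha : ∀ o, Measurable (a o)) {B : ℝ}
    (hB : ∀ o x, |a o x| ≤ B) {α z : ℝ} (hα : 0 ≤ α) (hz : stdNormalCDF z = 1 - α)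
    {c : ℕ → Ω → ℝ} (hcm : ∀ M, Measurable (c M))
    (hc : ∀ᵐ ω ∂μ, Tendsto (fun M => c M ω) atTop (𝓝 z)) {θ : ℝ} (hθ : popMean ν w a ≤ θ) :
    ∃ p, 1 - α ≤ p ∧ (popMean ν w a < θ → p = 1) ∧
      Tendsto (fun M : ℕ => μ.real {ω | aggMean w M (fun o i => a o (ξ (o, i) ω))
        - c M ω * aggSd w M (fun o i => a o (ξ (o, i) ω)) / √(M : ℝ) ≤ θ}) atTop (𝓝 p) := by
  have hmean := ae_tendsto_aggMean (w := w) hξ hlaw hind ha hB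
  have hsd := ae_tendsto_aggSd (w := w) hξ hlaw hind ha hB
  have hmm := measurable_aggMean (w := w) hξ ha
  have hms := measurable_aggSd (w := w) hξ ha
  rcases hθ.lt_or_eq with hlt | heq
  · refine ⟨1, by linarith, fun _ => rfl, tendsto_measureReal_le_one (l := popMean ν w a)
      (fun M => ?_) ?_ hlt⟩
    · exact ((hmm M).sub (((hcm M).mul (hms M)).div_const _)).aemeasurable
    · have hs : Tendsto (fun M : ℕ => √(M : ℝ)) atTop atTop :=
        Real.tendsto_sqrt_atTop.comp tendsto_natCast_atTop_atTop
      filter_upwards [hmean, hsd, hc] with ω h1 h2 h3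
      have := h1.sub ((h3.mul h2).div_atTop hs)
      rwa [sub_zero] at this
  rcases popVar_nonneg (ν := ν) (w := w) (a := a) |>.lt_or_eq with hv | hv
  · refine ⟨1 - α, le_rfl, fun h => absurd heq h.ne, ?_⟩
    have hσ : 0 < √(popVar ν w a) := Real.sqrt_pos.2 hv
    have hv' : (popVar ν w a).toNNReal ≠ 0 := by simpa using hv
    have key := tendsto_measureReal_le_zero
      (tendstoInDistribution_aggMean (w := w) hξ hlaw hind ha hB)
      (κ := fun M ω => c M ω * aggSd w M (fun o i => a o (ξ (o, i) ω)))
      (k := z * √(popVar ν w a)) (fun M => ((hcm M).mul (hms M)).aemeasurable)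
      (by filter_upwards [hsd, hc] with ω h2 h3 using h3.mul h2)
      (g := fun p => p.1 - p.2) (by fun_prop) (by
        simp only [sub_eq_zero, ofPred_eq_eq_singleton]
        exact gaussianReal_measure_singleton hv' _)
    have hlim := gaussianReal_real_Iic_mul hσ z
    rw [Real.sq_sqrt hv.le, hz] at hlim
    simp only [sub_nonpos] at key
    rw [show {x : ℝ | x ≤ z * √(popVar ν w a)} = Iic (z * √(popVar ν w a)) from rfl, hlim] at key
    refine key.congr' ?_
    filter_upwards [eventually_ne_atTop 0] with M hM
    have hM' : 0 < √(M : ℝ) := Real.sqrt_pos.2 (by exact_mod_cast Nat.pos_of_ne_zero hM)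
    congr 1
    ext ω
    simp only [mem_ofPred_eq]
    rw [← heq, sub_le_comm, le_div_iff₀ hM', mul_comm]
  · refine ⟨1, by linarith, fun _ => rfl, ?_⟩
    refine tendsto_const_nhds.congr' ?_
    filter_upwards [eventually_ne_atTop 0] with M hM
    rw [eq_comm, ← probReal_univ (μ := μ)]
    refine measureReal_congr ?_
    filter_upwards [ae_eq_of_popVar_eq_zero (w := w) hξ hlaw ha hB hv.symm] with ω hω
    refine propext ⟨fun _ => trivial, fun _ => ?_⟩
    obtain ⟨e1, e2⟩ := hω M hM
    change _ - _ ≤ _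
    rw [e1, e2]
    simpa using hθ

/-- Coverage of the mean by the symmetric confidence interval with a fixed critical value. -/
lemma tendsto_two_sided_coverage (hξ : ∀ p, Measurable (ξ p))
    (hlaw : ∀ p, μ.map (ξ p) = ν) (hind : iIndepFun ξ μ) (ha : ∀ o, Measurable (a o)) {B : ℝ}
    (hB : ∀ o x, |a o x| ≤ B) (hv : 0 < popVar ν w a) {c : ℝ} (hc : 0 ≤ c) :
    Tendsto (fun M : ℕ => μ.real {ω | popMean ν w a ∈
      confInterval w M (fun o i => a o (ξ (o, i) ω)) (fun o i => a o (ξ (o, i) ω)) c}) atTop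
      (𝓝 (stdNormalCDF c - stdNormalCDF (-c))) := by
  have hσ : 0 < √(popVar ν w a) := Real.sqrt_pos.2 hv
  have hv' : (popVar ν w a).toNNReal ≠ 0 := by simpa using hv
  have key := tendsto_measureReal_le_zero
    (tendstoInDistribution_aggMean (w := w) hξ hlaw hind ha hB)
    (κ := fun M ω => c * aggSd w M (fun o i => a o (ξ (o, i) ω)))
    (k := c * √(popVar ν w a))
    (fun M => ((measurable_aggSd hξ ha M).const_mul c).aemeasurable)
    (by filter_upwards [ae_tendsto_aggSd (w := w) hξ hlaw hind ha hB] with ω h using h.const_mul c)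
    (g := fun p => |p.1| - p.2) (by fun_prop) (by
      refine measure_mono_null (t := {c * √(popVar ν w a)} ∪ {-(c * √(popVar ν w a))}) ?_
        (measure_union_null (gaussianReal_measure_singleton hv' _)
          (gaussianReal_measure_singleton hv' _))
      intro x hx
      exact eq_or_eq_neg_of_abs_eq (sub_eq_zero.1 hx))
  have hlim := gaussianReal_real_abs_le hσ hc
  rw [Real.sq_sqrt hv.le] at hlim
  simp only [sub_nonpos] at key
  rw [hlim] at key
  refine key.congr' ?_
  filter_upwards [eventually_ne_atTop 0] with M hM
  have hM' : 0 < √(M : ℝ) := Real.sqrt_pos.2 (by exact_mod_cast Nat.pos_of_ne_zero hM)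
  congr 1
  ext ω
  simp only [mem_ofPred_eq, confInterval, mem_Icc]
  rw [abs_mul, abs_of_pos hM', mul_comm, ← le_div_iff₀ hM', abs_le]
  constructor <;> rintro ⟨h1, h2⟩ <;> constructor <;> linarith

/-- If ordered families have equal weighted means, their draws with positive weight agree almost
surely. -/
lemma ae_draws_eq_of_popMean_eq (hξ : ∀ p, Measurable (ξ p))
    (hlaw : ∀ p, μ.map (ξ p) = ν) (hw : ∀ o, 0 ≤ w o) (ha : ∀ o, Measurable (a o))
    (hb : ∀ o, Measurable (b o)) {B : ℝ} (hBa : ∀ o x, |a o x| ≤ B) (hBb : ∀ o x, |b o x| ≤ B)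
    (hab : ∀ o x, a o x ≤ b o x) (heq : popMean ν w a = popMean ν w b) :
    ∀ᵐ ω ∂μ, ∀ o, w o = 0 ∨ (fun i => a o (ξ (o, i) ω)) = fun i => b o (ξ (o, i) ω) := by
  refine ae_all_iff.2 fun o => ?_
  have : NeZero N := ⟨fun h => by subst h; exact o.elim0⟩
  have := isProbabilityMeasure_of_map hξ hlaw
  have hia : ∀ o, Integrable (a o) ν := fun o =>
    Integrable.of_bound (ha o).aestronglyMeasurable B (ae_of_all _ (hBa o))
  have hib : ∀ o, Integrable (b o) ν := fun o =>
    Integrable.of_bound (hb o).aestronglyMeasurable B (ae_of_all _ (hBb o))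
  have hsum : ∑ o, w o * (∫ x, (b o x - a o x) ∂ν) = 0 := by
    simp only [popMean] at heq
    simp_rw [fun o => integral_sub (hib o) (hia o), mul_sub]
    rw [Finset.sum_sub_distrib, heq, sub_self]
  have ho := (Finset.sum_eq_zero_iff_of_nonneg fun o _ => mul_nonneg (hw o)
    (integral_nonneg fun x => sub_nonneg.2 (hab o x))).1 hsum o (Finset.mem_univ o)
  rcases mul_eq_zero.1 ho with h | h
  · exact ae_of_all _ fun ω => Or.inl h
  · have h1 := (integral_eq_zero_iff_of_nonneg (fun x => sub_nonneg.2 (hab o x))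
      ((hib o).sub (hia o))).1 h
    have h2 : ∀ᵐ ω ∂μ, ∀ i, b o (ξ (o, i) ω) - a o (ξ (o, i) ω) = 0 := by
      refine ae_all_iff.2 fun i => ?_
      rw [← hlaw (o, i)] at h1
      exact ae_of_ae_map (hξ _).aemeasurable h1
    filter_upwards [h2] with ω hω
    exact Or.inr (funext fun i => (sub_eq_zero.1 (hω i)).symm)

/-- The limiting worst-case coverage of the simulated confidence interval, for any set of
parameters between the two means. -/
theorem exists_tendsto_iInf_coverage {ι : Type*} [Nonempty ι] (hξ : ∀ p, Measurable (ξ p))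
    (hlaw : ∀ p, μ.map (ξ p) = ν) (hind : iIndepFun ξ μ) (hw : ∀ o, 0 ≤ w o)
    (ha : ∀ o, Measurable (a o))
    (hb : ∀ o, Measurable (b o)) {B : ℝ} (hBa : ∀ o x, |a o x| ≤ B) (hBb : ∀ o x, |b o x| ≤ B)
    (hab : ∀ o x, a o x ≤ b o x) {θ : ι → ℝ}
    (hθ : ∀ i, θ i ∈ Icc (popMean ν w a) (popMean ν w b)) {α : ℝ} (hα : 0 < α) (hα' : α < 1)
    {c : ℕ → Ω → ℝ}
    (hc : ∀ᵐ ω ∂μ, ∀ M, IsCriticalValue α w M (fun o i => a o (ξ (o, i) ω))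
      (fun o i => b o (ξ (o, i) ω)) (c M ω)) :
    ∃ p, 1 - α ≤ p ∧ Tendsto (fun M : ℕ => ⨅ i, μ.real {ω | θ i ∈ confInterval w M
      (fun o i => a o (ξ (o, i) ω)) (fun o i => b o (ξ (o, i) ω)) (c M ω)}) atTop (𝓝 p) := by
  -- The critical value is a measurable function of the simulated standardized distance.
  set t : ℕ → Ω → ℝ := fun M ω => √(M : ℝ) * ((aggMean w M (fun o i => b o (ξ (o, i) ω)) -
    aggMean w M (fun o i => a o (ξ (o, i) ω))) / max (aggSd w M (fun o i => a o (ξ (o, i) ω)))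
      (aggSd w M (fun o i => b o (ξ (o, i) ω)))) with ht
  set C : ℕ → Ω → ℝ := fun M ω => criticalValue α (t M ω) with hC
  have hma := measurable_aggMean (w := w) hξ ha
  have hmb := measurable_aggMean (w := w) hξ hb
  have hsa := measurable_aggSd (w := w) hξ ha
  have hsb := measurable_aggSd (w := w) hξ hb
  have hCm : ∀ M, Measurable (C M) := fun M =>
    (antitone_criticalValue hα hα').measurable.comp
      ((((hmb M).sub (hma M)).div ((hsa M).max (hsb M))).const_mul _)
  have hcC : ∀ᵐ ω ∂μ, ∀ M, c M ω = C M ω := by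
    filter_upwards [hc] with ω hω M using eq_criticalValue hα hα' (hω M)
  have hprob : ∀ (M : ℕ) i, μ.real {ω | θ i ∈ confInterval w M (fun o i => a o (ξ (o, i) ω))
      (fun o i => b o (ξ (o, i) ω)) (c M ω)} = μ.real {ω | θ i ∈ confInterval w M
      (fun o i => a o (ξ (o, i) ω)) (fun o i => b o (ξ (o, i) ω)) (C M ω)} := by
    intro M i
    refine measureReal_congr ?_
    filter_upwards [hcC] with ω hω
    change (_ ∈ confInterval w M _ _ (c M ω)) = (_ ∈ confInterval w M _ _ (C M ω))
    rw [hω M]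
  simp only [hprob]
  have hva := popVar_nonneg (ν := ν) (w := w) (a := a)
  have hvb := popVar_nonneg (ν := ν) (w := w) (a := b)
  have hsda := ae_tendsto_aggSd (w := w) hξ hlaw hind ha hBa
  have hsdb := ae_tendsto_aggSd (w := w) hξ hlaw hind hb hBb
  by_cases h0 : popVar ν w a = 0 ∧ popVar ν w b = 0
  · -- No simulation noise: the interval is exact.
    refine ⟨1, by linarith, tendsto_const_nhds.congr' ?_⟩
    filter_upwards [eventually_ne_atTop 0] with M hM
    have hone : ∀ i, μ.real {ω | θ i ∈ confInterval w M
      (fun o i => a o (ξ (o, i) ω)) (fun o i => b o (ξ (o, i) ω)) (C M ω)} = 1 := by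
      intro i
      rw [← probReal_univ (μ := μ)]
      refine measureReal_congr ?_
      filter_upwards [ae_eq_of_popVar_eq_zero (w := w) hξ hlaw ha hBa h0.1,
        ae_eq_of_popVar_eq_zero (w := w) hξ hlaw hb hBb h0.2] with ω h1 h2
      refine propext ⟨fun _ => trivial, fun _ => ?_⟩
      change θ i ∈ confInterval _ _ _ _ _
      simp only [confInterval, (h1 M hM).1, (h1 M hM).2, (h2 M hM).1, (h2 M hM).2]
      simpa using hθ i
    simp only [hone, ciInf_const]
  have hmax : 0 < max (√(popVar ν w a)) (√(popVar ν w b)) := by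
    rw [lt_max_iff, Real.sqrt_pos, Real.sqrt_pos]
    by_contra! h
    exact h0 ⟨le_antisymm h.1 hva, le_antisymm h.2 hvb⟩
  obtain ⟨i₀⟩ := ‹Nonempty ι›
  rcases ((hθ i₀).1.trans (hθ i₀).2).lt_or_eq with hlt | heq
  · -- Separated means: the critical values converge to the one-sided quantile.
    obtain ⟨z, hz⟩ := exists_stdNormalCDF_eq (p := 1 - α) (by linarith) (by linarith)
    have hCz : ∀ᵐ ω ∂μ, Tendsto (fun M => C M ω) atTop (𝓝 z) := by
      filter_upwards [ae_tendsto_aggMean (w := w) hξ hlaw hind ha hBa,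
        ae_tendsto_aggMean (w := w) hξ hlaw hind hb hBb, hsda, hsdb] with ω h1 h2 h3 h4
      refine (tendsto_criticalValue_atTop hα hα' hz).comp ?_
      refine Tendsto.atTop_mul_pos (div_pos (sub_pos.2 hlt) hmax)
        (Real.tendsto_sqrt_atTop.comp tendsto_natCast_atTop_atTop) ?_
      exact (h2.sub h1).div (h3.max h4) hmax.ne'
    have hbb : BddBelow (range θ) := ⟨_, by rintro _ ⟨i, rfl⟩; exact (hθ i).1⟩
    have hba : BddAbove (range θ) := ⟨_, by rintro _ ⟨i, rfl⟩; exact (hθ i).2⟩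
    have hne : Nonempty ι := ⟨i₀⟩
    set X : ℕ → Ω → ℝ := fun M ω => aggMean w M (fun o i => a o (ξ (o, i) ω))
      - C M ω * aggSd w M (fun o i => a o (ξ (o, i) ω)) / √(M : ℝ) with hX
    set Y : ℕ → Ω → ℝ := fun M ω => aggMean w M (fun o i => b o (ξ (o, i) ω))
      + C M ω * aggSd w M (fun o i => b o (ξ (o, i) ω)) / √(M : ℝ) with hY
    have hXm : ∀ M, AEMeasurable (X M) μ := fun M =>
      ((hma M).sub (((hCm M).mul (hsa M)).div_const _)).aemeasurable
    have hYm : ∀ M, AEMeasurable (Y M) μ := fun M =>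
      ((hmb M).add (((hCm M).mul (hsb M)).div_const _)).aemeasurable
    have hlow : ∀ s, popMean ν w a ≤ s → ∃ p, 1 - α ≤ p ∧ (popMean ν w a < s → p = 1) ∧
        Tendsto (fun M => μ.real {ω | X M ω ≤ s}) atTop (𝓝 p) := fun s hs =>
      exists_tendsto_lower_coverage hξ hlaw hind ha hBa hα.le hz hCm hCz hs
    have hupp : ∀ s, s ≤ popMean ν w b → ∃ p, 1 - α ≤ p ∧ (s < popMean ν w b → p = 1) ∧
        Tendsto (fun M => μ.real {ω | s ≤ Y M ω}) atTop (𝓝 p) := by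
      intro s hs
      obtain ⟨p, h1, h2, h3⟩ := exists_tendsto_lower_coverage (a := fun o x => -b o x) (w := w)
        (θ := -s) (B := B) hξ hlaw hind (fun o => (hb o).neg) (fun o x => by simpa using hBb o x)
        hα.le hz hCm hCz (by rw [popMean_neg]; linarith)
      rw [popMean_neg, neg_lt_neg_iff] at h2
      refine ⟨p, h1, h2, h3.congr fun M => ?_⟩
      congr 1
      ext ω
      simp only [mem_ofPred_eq, aggMean_neg, aggSd_neg, hY]
      constructor <;> intro h <;> linarith
    obtain ⟨p, hp, -, hpt⟩ := hlow (⨅ i, θ i) (le_ciInf fun i => (hθ i).1)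
    obtain ⟨q, hq, -, hqt⟩ := hupp (⨆ i, θ i) (ciSup_le fun i => (hθ i).2)
    set m := (popMean ν w a + popMean ν w b) / 2 with hm
    obtain ⟨p', -, hp', hpt'⟩ := hlow m (by linarith)
    obtain ⟨q', -, hq', hqt'⟩ := hupp m (by linarith)
    rw [hp' (by linarith)] at hpt'
    rw [hq' (by linarith)] at hqt'
    refine ⟨min p q, le_min hp hq, tendsto_of_tendsto_of_tendsto_of_le_of_le ?_ (hpt.min hqt)
      (fun M => le_iInf_coverage (hXm M) (hYm M) hbb hba m)
      fun M => le_min (iInf_coverage_le_left (hXm M) hbb) (iInf_coverage_le_right (hYm M) hba)⟩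
    have := ((hpt.add hqt').sub_const 1).min ((hqt.add hpt').sub_const 1)
    simpa using this
  · -- Equal means: the two simulated families agree and the critical value is constant.
    have hdraw := ae_draws_eq_of_popMean_eq hξ hlaw hw ha hb hBa hBb hab heq
    have hagg : ∀ᵐ ω ∂μ, ∀ M, aggMean w M (fun o i => b o (ξ (o, i) ω))
        = aggMean w M (fun o i => a o (ξ (o, i) ω)) ∧ aggSd w M (fun o i => b o (ξ (o, i) ω))
        = aggSd w M (fun o i => a o (ξ (o, i) ω)) := by
      filter_upwards [hdraw] with ω hω M
      constructor
      · refine Finset.sum_congr rfl fun o _ => ?_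
        rcases hω o with h | h
        · simp [h]
        · simp only [h]
      · unfold aggSd
        congr 1
        refine Finset.sum_congr rfl fun o _ => ?_
        rcases hω o with h | h
        · simp [h]
        · simp only [h]
    have hvar : √(popVar ν w b) = √(popVar ν w a) := by
      obtain ⟨ω, h1, h2, h3⟩ := (hsda.and (hsdb.and hagg)).exists
      exact tendsto_nhds_unique h2 (h1.congr fun M => ((h3 M).2).symm)
    rw [hvar, max_self, Real.sqrt_pos] at hmax
    have hspec := criticalValue_spec hα hα' 0
    rw [add_zero] at hspec
    have hc0 : 0 ≤ criticalValue α 0 := by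
      by_contra! hneg
      have := strictMono_stdNormalCDF (show criticalValue α 0 < -criticalValue α 0 by linarith)
      linarith
    refine ⟨1 - α, le_rfl, ?_⟩
    have key := tendsto_two_sided_coverage hξ hlaw hind ha hBa hmax hc0
    rw [hspec] at key
    refine key.congr fun M => ?_
    have hne : Nonempty ι := ⟨i₀⟩
    have hconst : ∀ i, μ.real {ω | θ i ∈ confInterval w M
        (fun o i => a o (ξ (o, i) ω)) (fun o i => b o (ξ (o, i) ω)) (C M ω)} =
        μ.real {ω | popMean ν w a ∈ confInterval w M (fun o i => a o (ξ (o, i) ω))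
          (fun o i => a o (ξ (o, i) ω)) (criticalValue α 0)} := by
      intro i
      have hθi : θ i = popMean ν w a := le_antisymm (heq ▸ (hθ i).2) (hθ i).1
      refine measureReal_congr ?_
      filter_upwards [hagg] with ω hω
      change (_ ∈ confInterval _ _ _ _ _) = (_ ∈ confInterval _ _ _ _ _)
      simp only [hθi, hC, ht, confInterval, (hω M).1, (hω M).2, sub_self, zero_div, mul_zero]
    simp only [hconst, ciInf_const]

end coverage

/-! ### The open cube and the law of the heterogeneity -/

lemma isOpen_openCube (ι : Type) [Finite ι] : IsOpen (openCube ι) :=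
  isOpen_set_pi finite_univ fun _ _ => isOpen_Ioo

lemma measurableSet_openCube (ι : Type) [Finite ι] : MeasurableSet (openCube ι) :=
  (isOpen_openCube ι).measurableSet

lemma glue_mem_openCube_iff {J : ℕ} {l : Finset (Fin J)} {x : {j // j ∈ l} → ℝ}
    {y : {j // j ∉ l} → ℝ} :
    glue l x y ∈ openCube (Fin J) ↔ x ∈ openCube {j // j ∈ l} ∧ y ∈ openCube {j // j ∉ l} := by
  simp only [openCube, mem_univ_pi, glue]
  constructor
  · intro h
    exact ⟨fun j => by simpa [j.2] using h j, fun j => by simpa [j.2] using h j⟩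
  · rintro ⟨hx, hy⟩ j
    by_cases hj : j ∈ l
    · simpa [hj] using hx ⟨j, hj⟩
    · simpa [hj] using hy ⟨j, hj⟩

lemma continuous_glue {J : ℕ} (l : Finset (Fin J)) (x : {j // j ∈ l} → ℝ) :
    Continuous (glue l x) := by
  refine continuous_pi fun j => ?_
  by_cases hj : j ∈ l
  · simp only [glue, hj, dite_true]; fun_prop
  · simp only [glue, hj, dite_false]; fun_prop

/-- Fubini's theorem for null sets of the cube split into the coordinates inside and outside
`l`. -/
lemma ae_ae_glue {J : ℕ} (l : Finset (Fin J)) {p : (Fin J → ℝ) → Prop}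
    (h : ∀ᵐ v ∂(volume.restrict (openCube (Fin J))), p v) :
    ∀ᵐ x ∂(volume.restrict (openCube {j // j ∈ l})),
      ∀ᵐ y ∂(volume.restrict (openCube {j // j ∉ l})), p (glue l x y) := by
  have hmp := (volume_preserving_piEquivPiSubtypeProd (fun _ : Fin J => ℝ) (· ∈ l)).symm
  have hg : ∀ z, (MeasurableEquiv.piEquivPiSubtypeProd (fun _ : Fin J => ℝ) (· ∈ l)).symm z
      = glue l z.1 z.2 := fun z => rfl
  have hr := hmp.restrict_preimage (measurableSet_openCube (Fin J))
  have hpre : (MeasurableEquiv.piEquivPiSubtypeProd (fun _ : Fin J => ℝ) (· ∈ l)).symm ⁻¹'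
      openCube (Fin J) = openCube {j // j ∈ l} ×ˢ openCube {j // j ∉ l} := by
    ext z
    rw [mem_preimage, hg, glue_mem_openCube_iff, mem_prod]
  rw [hpre, Measure.volume_eq_prod, ← Measure.prod_restrict] at hr
  -- The two sides carry different, equal, `Fintype` instances on the subtype.
  convert! Measure.ae_ae_of_ae_prod (hr.quasiMeasurePreserving.ae h)

section population

variable {J T W : ℕ} {Ω : Type*} [MeasurableSpace Ω] {P : Measure Ω}

/-- The law of `V` is carried by the open cube. -/
lemma Population.ae_mem_openCube (pop : Population J T W P) :
    ∀ᵐ v ∂(P.map pop.V), v ∈ openCube (Fin J) := by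
  rw [pop.law_V]
  exact (withDensity_absolutelyContinuous _ _).ae_le
    (ae_restrict_mem (measurableSet_openCube _))

lemma Population.integrableOn_fV [IsProbabilityMeasure P] (pop : Population J T W P) :
    IntegrableOn pop.fV (openCube (Fin J)) := by
  refine ⟨pop.measurable_fV.aestronglyMeasurable, ?_⟩
  have h1 : (P.map pop.V) univ ≠ ⊤ := by
    have := Measure.isProbabilityMeasure_map (μ := P) pop.measurable_V.aemeasurable
    exact measure_ne_top _ _
  rw [pop.law_V, withDensity_apply _ MeasurableSet.univ, Measure.restrict_univ] at h1
  rw [hasFiniteIntegral_iff_ofReal (ae_of_all _ pop.fV_nonneg)]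
  exact h1.lt_top

lemma Population.integral_map_V (pop : Population J T W P) (g : (Fin J → ℝ) → ℝ) :
    ∫ v, g v ∂(P.map pop.V) = ∫ v in openCube (Fin J), g v * pop.fV v := by
  rw [pop.law_V, integral_withDensity_eq_integral_toReal_smul
    pop.measurable_fV.ennreal_ofReal (ae_of_all _ fun _ => ENNReal.ofReal_lt_top)]
  refine integral_congr_ae (ae_of_all _ fun v => ?_)
  simp only [ENNReal.toReal_ofReal (pop.fV_nonneg v), smul_eq_mul]
  exact mul_comm _ _

/-- The ranking of the conditional expectations is a ranking of the marginal treatment responses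
almost everywhere for the law of `V`. -/
lemma Population.ae_mtr_le (pop : Population J T W P) {k k' : Fin T} (h : k < k') :
    ∀ᵐ v ∂(P.map pop.V), pop.mtr k v ≤ pop.mtr k' v := by
  have h1 : ∀ᵐ ω ∂P, pop.mtr k (pop.V ω) ≤ pop.mtr k' (pop.V ω) := by
    filter_upwards [pop.mtr_condExp k, pop.mtr_condExp k', pop.ranked k k' h] with ω e1 e2 h
    rwa [e1, e2] at h
  -- The responses are only measurable on the cube, which carries the law.
  have hopen : IsOpen (openCube (Fin J) ∩ {v | pop.mtr k' v - pop.mtr k v ∈ Iio (0 : ℝ)}) :=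
    ((pop.mtr_continuousOn k').sub (pop.mtr_continuousOn k)).isOpen_inter_preimage
      (isOpen_openCube _) isOpen_Iio
  have hnull : P.map pop.V
      (openCube (Fin J) ∩ {v | pop.mtr k' v - pop.mtr k v ∈ Iio (0 : ℝ)}) = 0 := by
    rw [Measure.map_apply pop.measurable_V hopen.measurableSet]
    refine measure_mono_null ?_ (ae_iff.1 h1)
    rintro ω ⟨-, hω⟩
    exact not_le.2 (sub_neg.1 hω)
  have h2 := measure_eq_zero_iff_ae_notMem.1 hnull
  filter_upwards [h2, pop.ae_mem_openCube] with v hv hc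
  by_contra! hlt
  exact hv ⟨hc, sub_neg.2 hlt⟩

/-! ### Conditional means, and the identified set -/

/-- The weighting function in a conditional mean is integrable for every `x`: where the density
is not integrable in the remaining coordinates, the marginal density is `0` by convention and so
is the quotient. -/
lemma integrable_conditional_density {f : (Fin J → ℝ) → ℝ} (l : Finset (Fin J))
    (x : {j // j ∈ l} → ℝ) :
    IntegrableOn (fun y => f (glue l x y) / marginalDensity f l x) (openCube {j // j ∉ l}) := by
  by_cases h : IntegrableOn (fun y => f (glue l x y)) (openCube {j // j ∉ l})
  · exact h.div_const _
  · have : marginalDensity f l x = 0 := integral_undef h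
    simp only [this, div_zero]
    exact integrableOn_zero

lemma integrable_condMean {f g : (Fin J → ℝ) → ℝ} {C : ℝ} (l : Finset (Fin J))
    {x : {j // j ∈ l} → ℝ} (hx : x ∈ openCube {j // j ∈ l})
    (hg : ContinuousOn g (openCube (Fin J))) (hC : ∀ v ∈ openCube (Fin J), g v ∈ Ioo 0 C) :
    IntegrableOn (fun y => g (glue l x y) * (f (glue l x y) / marginalDensity f l x))
      (openCube {j // j ∉ l}) := by
  have hmem : ∀ y ∈ openCube {j // j ∉ l}, glue l x y ∈ openCube (Fin J) := fun y hy =>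
    glue_mem_openCube_iff.2 ⟨hx, hy⟩
  refine (integrable_conditional_density l x).bdd_mul (c := C) ?_ ?_
  · exact (hg.comp (continuous_glue l x).continuousOn hmem).aestronglyMeasurable
      (measurableSet_openCube _)
  · filter_upwards [ae_restrict_mem (measurableSet_openCube _)] with y hy
    have := hC _ (hmem y hy)
    rw [Real.norm_eq_abs, abs_of_pos this.1]
    exact this.2.le

/-- Conditional means are linear in the response for every `x` in the cube, not only almost
everywhere. -/
lemma condMean_combination {f g h : (Fin J → ℝ) → ℝ} {C : ℝ} (l : Finset (Fin J))
    {x : {j // j ∈ l} → ℝ} (hx : x ∈ openCube {j // j ∈ l})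
    (hg : ContinuousOn g (openCube (Fin J))) (hgC : ∀ v ∈ openCube (Fin J), g v ∈ Ioo 0 C)
    (hh : ContinuousOn h (openCube (Fin J))) (hhC : ∀ v ∈ openCube (Fin J), h v ∈ Ioo 0 C)
    (s t : ℝ) :
    condMean f (s • g + t • h) l x = s * condMean f g l x + t * condMean f h l x := by
  simp only [condMean]
  rw [← integral_const_mul, ← integral_const_mul,
    ← integral_add ((integrable_condMean l hx hg hgC).const_mul s)
      ((integrable_condMean l hx hh hhC).const_mul t)]
  refine integral_congr_ae (ae_of_all _ fun y => ?_)
  simp only [Pi.add_apply, Pi.smul_apply, smul_eq_mul]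
  ring

/-- Conditional means preserve an almost sure ranking. -/
lemma Population.condMean_mono (pop : Population J T W P) {g h : (Fin J → ℝ) → ℝ} {C : ℝ}
    (hg : ContinuousOn g (openCube (Fin J))) (hgC : ∀ v ∈ openCube (Fin J), g v ∈ Ioo 0 C)
    (hh : ContinuousOn h (openCube (Fin J))) (hhC : ∀ v ∈ openCube (Fin J), h v ∈ Ioo 0 C)
    (hle : ∀ᵐ v ∂(P.map pop.V), g v ≤ h v) (l : Finset (Fin J)) :
    ∀ᵐ x ∂(volume.restrict (openCube {j // j ∈ l})),
      condMean pop.fV g l x ≤ condMean pop.fV h l x := by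
  rw [pop.law_V, ae_withDensity_iff pop.measurable_fV.ennreal_ofReal] at hle
  filter_upwards [ae_ae_glue l hle, ae_restrict_mem (measurableSet_openCube _)] with x hx hmem
  refine integral_mono_ae (integrable_condMean l hmem hg hgC) (integrable_condMean l hmem hh hhC) ?_
  filter_upwards [hx] with y hy
  have hm : 0 ≤ marginalDensity pop.fV l x := integral_nonneg fun y => pop.fV_nonneg _
  rcases (pop.fV_nonneg (glue l x y)).eq_or_lt with h0 | h0
  · simp [← h0]
  · exact mul_le_mul_of_nonneg_right (hy (by simpa using h0)) (div_nonneg h0.le hm)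

/-- The true marginal treatment responses belong to the identified set. -/
lemma Population.mtr_mem_identifiedSet (pop : Population J T W P) (A : Mechanism J T)
    (K : Finset (Fin T)) : pop.mtr ∈ identifiedSet pop A K := by
  have hmono : ∀ k k', k < k' → ∀ l, ∀ᵐ x ∂(volume.restrict (openCube {j // j ∈ l})),
      condMean pop.fV (pop.mtr k) l x ≤ condMean pop.fV (pop.mtr k') l x := fun k k' h l =>
    pop.condMean_mono (pop.mtr_continuousOn k) (pop.mtr_mem k) (pop.mtr_continuousOn k')
      (pop.mtr_mem k') (pop.ae_mtr_le h) l
  exact ⟨fun k _ => ⟨pop.mtr_continuousOn k, pop.mtr_mem k, fun l _ => ae_of_all _ fun _ => rfl,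
    fun k' h l _ => hmono k' k h l, fun k' h l _ => hmono k k' h l⟩,
    fun k _ k' _ h => pop.ae_mtr_le h⟩

lemma convex_identifiedSingle (pop : Population J T W P) (A : Mechanism J T) (k : Fin T) :
    Convex ℝ (identifiedSingle pop A k) := by
  rintro g ⟨hg, hgC, g1, g2, g3⟩ h ⟨hh, hhC, h1, h2, h3⟩ s t hs ht hst
  refine ⟨(hg.const_smul s).add (hh.const_smul t), fun v hv => ?_, fun l hl => ?_,
    fun k' hk l hl => ?_, fun k' hk l hl => ?_⟩
  · exact (convex_Ioo (0 : ℝ) pop.Ybar) (hgC v hv) (hhC v hv) hs ht hst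
  · filter_upwards [g1 l hl, h1 l hl, ae_restrict_mem (measurableSet_openCube _)] with x e1 e2 hx
    rw [condMean_combination l hx hg hgC hh hhC, ← e1, ← e2, ← add_mul, hst, one_mul]
  · filter_upwards [g2 k' hk l hl, h2 k' hk l hl, ae_restrict_mem (measurableSet_openCube _)]
      with x e1 e2 hx
    rw [condMean_combination l hx hg hgC hh hhC]
    calc _ = s * condMean pop.fV (pop.mtr k') l x + t * condMean pop.fV (pop.mtr k') l x := by
          rw [← add_mul, hst, one_mul]
      _ ≤ _ := add_le_add (mul_le_mul_of_nonneg_left e1 hs) (mul_le_mul_of_nonneg_left e2 ht)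
  · filter_upwards [g3 k' hk l hl, h3 k' hk l hl, ae_restrict_mem (measurableSet_openCube _)]
      with x e1 e2 hx
    rw [condMean_combination l hx hg hgC hh hhC]
    calc _ ≤ s * condMean pop.fV (pop.mtr k') l x + t * condMean pop.fV (pop.mtr k') l x :=
          add_le_add (mul_le_mul_of_nonneg_left e1 hs) (mul_le_mul_of_nonneg_left e2 ht)
      _ = _ := by rw [← add_mul, hst, one_mul]

lemma convex_identifiedSet (pop : Population J T W P) (A : Mechanism J T) (K : Finset (Fin T)) :
    Convex ℝ (identifiedSet pop A K) := by
  rintro m ⟨m1, m2⟩ n ⟨n1, n2⟩ s t hs ht hst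
  refine ⟨fun k hk => convex_identifiedSingle pop A k (m1 k hk) (n1 k hk) hs ht hst,
    fun k hk k' hk' h => ?_⟩
  filter_upwards [m2 k hk k' hk' h, n2 k hk k' hk' h] with v e1 e2
  exact add_le_add (mul_le_mul_of_nonneg_left e1 hs) (mul_le_mul_of_nonneg_left e2 ht)

end population

/-! ### The effect at given heterogeneity and its pointwise bounds -/

section effect

variable {J T : ℕ}

lemma abs_d_sub_d_le_one (A A' : Mechanism J T) (k : Fin T) (v q q' : Fin J → ℝ) :
    |A'.d k v q' - A.d k v q| ≤ 1 := by
  have h1 := A'.zero_or_one k v q'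
  have h2 := A.zero_or_one k v q
  simp only [Mechanism.d]
  rcases h1 with h1 | h1 <;> rcases h2 with h2 | h2 <;> simp [h1, h2]

lemma measurable_d (A : Mechanism J T) (k : Fin T) (q : Fin J → ℝ) :
    Measurable fun v => A.d k v q := by
  unfold Mechanism.d thresholdPoly
  refine Finset.measurable_fun_sum _ fun l _ => ?_
  refine Measurable.const_mul (Finset.measurable_fun_prod _ fun j _ => ?_) _
  exact Measurable.ite (measurableSet_lt (measurable_pi_apply j) measurable_const)
    measurable_const measurable_const

variable {A A' : Mechanism J T} {q q' : Fin J → ℝ} {K : Finset (Fin T)}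

/-- Only the responses to treatments in `K` matter for the effect. -/
lemma effectAt_eq_sum (hK : ∀ k, k ∉ K → ∀ v ∈ openCube (Fin J), A'.d k v q' = A.d k v q)
    (m : Fin T → (Fin J → ℝ) → ℝ) {v : Fin J → ℝ} (hv : v ∈ openCube (Fin J)) :
    effectAt A A' q q' m v = ∑ k ∈ K, (A'.d k v q' - A.d k v q) * m k v := by
  rw [effectAt, eq_comm]
  refine Finset.sum_subset (Finset.subset_univ _) fun k _ hk => ?_
  rw [hK k hk v hv, sub_self, zero_mul]

/-- The families whose components in `K` are continuous on the open cube, with values in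
`(0, C)`. -/
def admissible (K : Finset (Fin T)) (C : ℝ) : Set (Fin T → (Fin J → ℝ) → ℝ) :=
  {m | ∀ k ∈ K, ContinuousOn (m k) (openCube (Fin J)) ∧ ∀ v ∈ openCube (Fin J), m k v ∈ Ioo 0 C}

lemma identifiedSet_subset_admissible {W : ℕ} {Ω : Type*} [MeasurableSpace Ω] {P : Measure Ω}
    (pop : Population J T W P) (A : Mechanism J T) (K : Finset (Fin T)) :
    identifiedSet pop A K ⊆ admissible K pop.Ybar :=
  fun _ hm k hk => ⟨(hm.1 k hk).1, (hm.1 k hk).2.1⟩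

variable {C : ℝ} {m : Fin T → (Fin J → ℝ) → ℝ} {I : Set (Fin T → (Fin J → ℝ) → ℝ)}

lemma abs_effectAt_le (hK : ∀ k, k ∉ K → ∀ v ∈ openCube (Fin J), A'.d k v q' = A.d k v q)
    (hm : m ∈ admissible K C) {v : Fin J → ℝ} (hv : v ∈ openCube (Fin J)) :
    |effectAt A A' q q' m v| ≤ K.card * C := by
  rw [effectAt_eq_sum hK m hv]
  refine (Finset.abs_sum_le_sum_abs _ _).trans ?_
  rw [← nsmul_eq_mul]
  refine Finset.sum_le_card_nsmul _ _ _ fun k hk => ?_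
  have h1 := abs_d_sub_d_le_one A A' k v q q'
  have h2 := (hm k hk).2 v hv
  rw [abs_mul, abs_of_pos h2.1]
  exact (mul_le_of_le_one_left h2.1.le h1).trans h2.2.le

lemma aestronglyMeasurable_effectAt
    (hK : ∀ k, k ∉ K → ∀ v ∈ openCube (Fin J), A'.d k v q' = A.d k v q)
    (hm : m ∈ admissible K C) :
    AEStronglyMeasurable (effectAt A A' q q' m) (volume.restrict (openCube (Fin J))) := by
  have h : AEStronglyMeasurable (fun v => ∑ k ∈ K, (A'.d k v q' - A.d k v q) * m k v)
      (volume.restrict (openCube (Fin J))) := by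
    refine Finset.aestronglyMeasurable_fun_sum _ fun k hk => ?_
    exact ((measurable_d A' k q').sub (measurable_d A k q)).aestronglyMeasurable.mul
      ((hm k hk).1.aestronglyMeasurable (measurableSet_openCube _))
  refine h.congr ?_
  filter_upwards [ae_restrict_mem (measurableSet_openCube _)] with v hv
  exact (effectAt_eq_sum hK m hv).symm

lemma Population.integrable_effectAt {W : ℕ} {Ω : Type*} [MeasurableSpace Ω] {P : Measure Ω}
    [IsProbabilityMeasure P] (pop : Population J T W P)
    (hK : ∀ k, k ∉ K → ∀ v ∈ openCube (Fin J), A'.d k v q' = A.d k v q)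
    (hm : m ∈ admissible K C) : Integrable (effectAt A A' q q' m) (P.map pop.V) := by
  have := Measure.isProbabilityMeasure_map (μ := P) pop.measurable_V.aemeasurable
  refine Integrable.of_bound (C := K.card * C) ?_ ?_
  · refine (aestronglyMeasurable_effectAt hK hm).mono_ac ?_
    rw [pop.law_V]
    exact withDensity_absolutelyContinuous _ _
  · filter_upwards [pop.ae_mem_openCube] with v hv using abs_effectAt_le hK hm hv

lemma effectAt_swap (v : Fin J → ℝ) : effectAt A' A q' q m v = -effectAt A A' q q' m v := by
  simp only [effectAt, ← Finset.sum_neg_distrib]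
  exact Finset.sum_congr rfl fun k _ => by ring

lemma upperDelta_eq_neg (v : Fin J → ℝ) :
    upperDelta A A' I q q' v = -lowerDelta A' A I q' q v := by
  simp only [upperDelta, lowerDelta, iSup, iInf, effectAt_swap (A := A) (A' := A') (q := q)
    (q' := q')]
  rw [← Real.sSup_neg]
  congr 1
  ext r
  simp [Set.mem_neg, neg_eq_iff_eq_neg]

lemma bddBelow_effectAt (hK : ∀ k, k ∉ K → ∀ v ∈ openCube (Fin J), A'.d k v q' = A.d k v q)
    (hI : I ⊆ admissible K C) {v : Fin J → ℝ} (hv : v ∈ openCube (Fin J)) :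
    BddBelow (range fun m : I => effectAt A A' q q' m v) :=
  ⟨-(K.card * C), by rintro _ ⟨m, rfl⟩; exact (abs_le.1 (abs_effectAt_le hK (hI m.2) hv)).1⟩

lemma lowerDelta_le (hK : ∀ k, k ∉ K → ∀ v ∈ openCube (Fin J), A'.d k v q' = A.d k v q)
    (hI : I ⊆ admissible K C) (hm : m ∈ I) {v : Fin J → ℝ} (hv : v ∈ openCube (Fin J)) :
    lowerDelta A A' I q q' v ≤ effectAt A A' q q' m v :=
  ciInf_le (bddBelow_effectAt hK hI hv) ⟨m, hm⟩

lemma le_upperDelta (hK : ∀ k, k ∉ K → ∀ v ∈ openCube (Fin J), A'.d k v q' = A.d k v q)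
    (hI : I ⊆ admissible K C) (hm : m ∈ I) {v : Fin J → ℝ} (hv : v ∈ openCube (Fin J)) :
    effectAt A A' q q' m v ≤ upperDelta A A' I q q' v := by
  have h := lowerDelta_le (A := A') (A' := A) (q := q') (q' := q)
    (fun k hk v hv => (hK k hk v hv).symm) hI hm hv
  rw [effectAt_swap] at h
  rw [upperDelta_eq_neg]
  linarith

lemma abs_lowerDelta_le (hK : ∀ k, k ∉ K → ∀ v ∈ openCube (Fin J), A'.d k v q' = A.d k v q)
    (hI : I ⊆ admissible K C) (hne : I.Nonempty) {v : Fin J → ℝ} (hv : v ∈ openCube (Fin J)) :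
    |lowerDelta A A' I q q' v| ≤ K.card * C := by
  obtain ⟨m, hm⟩ := hne
  have : Nonempty I := ⟨⟨m, hm⟩⟩
  refine abs_le.2 ⟨le_ciInf fun m => (abs_le.1 (abs_effectAt_le hK (hI m.2) hv)).1, ?_⟩
  exact (lowerDelta_le hK hI hm hv).trans (abs_le.1 (abs_effectAt_le hK (hI hm) hv)).2

/-- The part of the open cube on which the threshold indicators at `q` and at `q'` equal `1`
exactly at the indices in `s` and in `s'`. -/
def thresholdCell (q q' : Fin J → ℝ) (s s' : Finset (Fin J)) : Set (Fin J → ℝ) :=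
  openCube (Fin J) ∩ ⋂ j, ({v | v j < q j ↔ j ∈ s} ∩ {v | v j < q' j ↔ j ∈ s'})

lemma measurableSet_thresholdCell (s s' : Finset (Fin J)) :
    MeasurableSet (thresholdCell q q' s s') := by
  have h : ∀ (q : Fin J → ℝ) (s : Finset (Fin J)) j,
      MeasurableSet {v : Fin J → ℝ | v j < q j ↔ j ∈ s} := fun q s j => by
    have hlt : MeasurableSet {v : Fin J → ℝ | v j < q j} :=
      measurableSet_lt (measurable_pi_apply j) measurable_const
    by_cases hj : j ∈ s
    · simpa [hj] using hlt
    · simp only [hj, iff_false]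
      exact hlt.compl
  exact (measurableSet_openCube _).inter (MeasurableSet.iInter fun j => (h q s j).inter (h q' s' j))

/-- The lower bound of the effect is measurable on the cube, although it is an infimum over an
uncountable family: on each of the finitely many threshold cells the effect is continuous for
every response family, so that the infimum is upper semicontinuous there. -/
lemma measurable_indicator_lowerDelta
    (hK : ∀ k, k ∉ K → ∀ v ∈ openCube (Fin J), A'.d k v q' = A.d k v q)
    (hI : I ⊆ admissible K C) :
    Measurable ((openCube (Fin J)).indicator (lowerDelta A A' I q q')) := by
  have hcell : ∀ s s', UpperSemicontinuousOn (lowerDelta A A' I q q')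
      (thresholdCell q q' s s') := by
    intro s s'
    refine upperSemicontinuousOn_ciInf (fun v hv => bddBelow_effectAt hK hI hv.1) fun m => ?_
    refine ContinuousOn.upperSemicontinuousOn ?_
    have hconst : ∀ (c : Finset (Fin J) → ℤ) v, v ∈ thresholdCell q q' s s' →
        thresholdPoly c v q = (∑ l, (c l : ℝ) * ∏ j ∈ l, if j ∈ s then 1 else 0) ∧
        thresholdPoly c v q' = ∑ l, (c l : ℝ) * ∏ j ∈ l, if j ∈ s' then 1 else 0 := by
      intro c v hv
      have hv' := fun j => mem_iInter.1 hv.2 j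
      have e1 : ∀ j, v j < q j ↔ j ∈ s := fun j => (hv' j).1
      have e2 : ∀ j, v j < q' j ↔ j ∈ s' := fun j => (hv' j).2
      simp only [thresholdPoly, thresholdInd, e1, e2, and_self]
    have hcont : ContinuousOn (fun v => ∑ k ∈ K,
        ((∑ l, (A'.coef k l : ℝ) * ∏ j ∈ l, if j ∈ s' then (1 : ℝ) else 0)
          - ∑ l, (A.coef k l : ℝ) * ∏ j ∈ l, if j ∈ s then (1 : ℝ) else 0) * m.1 k v)
        (thresholdCell q q' s s') :=
      continuousOn_finsetSum _ fun k hk =>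
        continuousOn_const.mul ((hI m.2 k hk).1.mono inter_subset_left)
    refine hcont.congr fun v hv => ?_
    rw [effectAt_eq_sum hK _ hv.1]
    refine Finset.sum_congr rfl fun k _ => ?_
    rw [Mechanism.d, Mechanism.d, (hconst (A'.coef k) v hv).2, (hconst (A.coef k) v hv).1]
  refine measurable_of_Iio fun r => ?_
  have hset : (openCube (Fin J)).indicator (lowerDelta A A' I q q') ⁻¹' Iio r =
      (⋃ s, ⋃ s', thresholdCell q q' s s' ∩ lowerDelta A A' I q q' ⁻¹' Iio r) ∪
        ((openCube (Fin J))ᶜ ∩ {_v | (0 : ℝ) < r}) := by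
    ext v
    by_cases hv : v ∈ openCube (Fin J)
    · simp only [mem_preimage, indicator_of_mem hv, mem_union, mem_iUnion, mem_inter_iff,
        mem_compl_iff, hv, not_true_eq_false, false_and, or_false]
      refine ⟨fun h => ⟨Finset.univ.filter fun j => v j < q j,
        Finset.univ.filter fun j => v j < q' j, ⟨hv, mem_iInter.2 fun j => ?_⟩, h⟩, ?_⟩
      · constructor <;> simp
      · rintro ⟨_, _, _, h⟩
        exact h
    · have hno : ∀ s s', v ∉ thresholdCell q q' s s' := fun s s' h => hv h.1
      simp [hv, hno]
  rw [hset]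
  refine (MeasurableSet.iUnion fun s => MeasurableSet.iUnion fun s' => ?_).union
    ((measurableSet_openCube _).compl.inter (MeasurableSet.const _))
  obtain ⟨u, hu, he⟩ := upperSemicontinuousOn_iff_preimage_Iio.1 (hcell s s') r
  rw [he]
  exact (measurableSet_thresholdCell s s').inter hu.measurableSet

end effect

/-! ### The gross policy relevant treatment effect -/

section gprte

variable {J T W N : ℕ} {Ω : Type*} [MeasurableSpace Ω] {P : Measure Ω} [IsProbabilityMeasure P]
  {A A' : Mechanism J T} {q q' : Fin N → Fin J → ℝ} {w : Fin N → ℝ} {K : Finset (Fin T)} {C : ℝ}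
  {m n : Fin T → (Fin J → ℝ) → ℝ}

/-- On admissible families the treatment effect is the weighted mean of the pointwise effects under
the law of `V`. -/
lemma Population.gprte_eq (pop : Population J T W P)
    (hK : ∀ k, k ∉ K → ∀ o, ∀ v ∈ openCube (Fin J), A'.d k v (q' o) = A.d k v (q o))
    (hm : m ∈ admissible K C) :
    gprte pop.fV A A' q q' w m = popMean (P.map pop.V) w fun o => effectAt A A' (q o) (q' o) m := by
  refine Finset.sum_congr rfl fun o _ => ?_
  rw [pop.integral_map_V]
  congr 1
  rw [← integral_finsetSum]
  · simp only [effectAt, Finset.sum_mul]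
  intro k _
  by_cases hk : k ∈ K
  · refine pop.integrableOn_fV.bdd_mul (c := C)
      (((measurable_d A' k (q' o)).sub (measurable_d A k (q o))).aestronglyMeasurable.mul
        ((hm k hk).1.aestronglyMeasurable (measurableSet_openCube _))) ?_
    filter_upwards [ae_restrict_mem (measurableSet_openCube _)] with v hv
    have h2 := (hm k hk).2 v hv
    rw [Real.norm_eq_abs, abs_mul, abs_of_pos h2.1]
    exact (mul_le_of_le_one_left h2.1.le (abs_d_sub_d_le_one A A' k v _ _)).trans h2.2.le
  · refine (integrableOn_zero (μ := volume)).congr_fun_ae ?_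
    filter_upwards [ae_restrict_mem (measurableSet_openCube _)] with v hv
    rw [hK k hk o v hv, sub_self, zero_mul, zero_mul]

lemma Population.gprte_combination (pop : Population J T W P)
    (hK : ∀ k, k ∉ K → ∀ o, ∀ v ∈ openCube (Fin J), A'.d k v (q' o) = A.d k v (q o))
    (hm : m ∈ admissible K C) (hn : n ∈ admissible K C) {s t : ℝ}
    (hmn : s • m + t • n ∈ admissible K C) :
    gprte pop.fV A A' q q' w (s • m + t • n) =
      s * gprte pop.fV A A' q q' w m + t * gprte pop.fV A A' q q' w n := by
  rw [pop.gprte_eq hK hm, pop.gprte_eq hK hn, pop.gprte_eq hK hmn]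
  simp only [popMean, Finset.mul_sum, ← Finset.sum_add_distrib]
  refine Finset.sum_congr rfl fun o _ => ?_
  have e : ∀ v, effectAt A A' (q o) (q' o) (s • m + t • n) v =
      s * effectAt A A' (q o) (q' o) m v + t * effectAt A A' (q o) (q' o) n v := fun v => by
    simp only [effectAt, Finset.mul_sum, ← Finset.sum_add_distrib, Pi.add_apply, Pi.smul_apply,
      smul_eq_mul]
    exact Finset.sum_congr rfl fun k _ => by ring
  have hK' := fun k hk => hK k hk o
  simp only [e]
  rw [integral_add ((pop.integrable_effectAt hK' hm).const_mul s)
    ((pop.integrable_effectAt hK' hn).const_mul t), integral_const_mul, integral_const_mul]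
  ring

end gprte

end HyperRect

open HyperRect
theorem theorem5 {J T W N : ℕ} {Ω Ω' : Type*} [MeasurableSpace Ω] [MeasurableSpace Ω']
    (P : Measure Ω) [IsProbabilityMeasure P] (pop : Population J T W P)
    (A A' : Mechanism J T) (Q Q' : (Fin W → ℝ) → Fin J → ℝ) (z : Fin N → Fin W → ℝ)
    (w : Fin N → ℝ) (hw : ∀ o, 0 ≤ w o) (hw_sum : ∑ o, w o = 1)
    (K : Finset (Fin T))
    (hK : ∀ k, k ∉ K → ∀ o, ∀ v ∈ openCube (Fin J),
      A'.d k v (Q' (z o)) = A.d k v (Q (z o)))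
    (I : Set (Fin T → (Fin J → ℝ) → ℝ)) (hI : I = identifiedSet pop A K)
    (ΔW : (Fin T → (Fin J → ℝ) → ℝ) → ℝ)
    (hΔW : ΔW = gprte pop.fV A A' (fun o => Q (z o)) (fun o => Q' (z o)) w)
    (μ : Measure Ω') [IsProbabilityMeasure μ] (ξ : Fin N × ℕ → Ω' → Fin J → ℝ)
    (hξ_meas : ∀ i, Measurable (ξ i)) (hξ_law : ∀ i, μ.map (ξ i) = P.map pop.V)
    (hξ_indep : iIndepFun ξ μ)
    (lo up : Ω' → Fin N → ℕ → ℝ)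
    (hlo : ∀ ω o i, lo ω o i = lowerDelta A A' I (Q (z o)) (Q' (z o)) (ξ (o, i) ω))
    (hup : ∀ ω o i, up ω o i = upperDelta A A' I (Q (z o)) (Q' (z o)) (ξ (o, i) ω))
    (α : ℝ) (hα : 0 < α) (hα_lt : α < 1)
    (c : ℕ → Ω' → ℝ) (hc : ∀ M ω, IsCriticalValue α w M (lo ω) (up ω) (c M ω)) :
    pop.mtr ∈ I ∧
    (ΔW '' I).OrdConnected ∧
    (∀ m ∈ I, ΔW m ∈ Set.Icc
      (∑ o, w o * ∫ v, lowerDelta A A' I (Q (z o)) (Q' (z o)) v ∂(P.map pop.V))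
      (∑ o, w o * ∫ v, upperDelta A A' I (Q (z o)) (Q' (z o)) v ∂(P.map pop.V))) ∧
    ∃ p : ℝ, 1 - α ≤ p ∧
      Filter.Tendsto
        (fun M : ℕ => ⨅ m : I, μ.real {ω | ΔW m ∈ confInterval w M (lo ω) (up ω) (c M ω)})
        Filter.atTop (nhds p) := by
  subst hI hΔW
  set I := identifiedSet pop A K with hI
  have hmtr : pop.mtr ∈ I := pop.mtr_mem_identifiedSet A K
  have hadm : I ⊆ admissible K pop.Ybar := identifiedSet_subset_admissible pop A K
  have hne : I.Nonempty := ⟨_, hmtr⟩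
  have hKo : ∀ o, ∀ k, k ∉ K → ∀ v ∈ openCube (Fin J),
      A'.d k v (Q' (z o)) = A.d k v (Q (z o)) := fun o k hk => hK k hk o
  have hKo' : ∀ o, ∀ k, k ∉ K → ∀ v ∈ openCube (Fin J),
      A.d k v (Q (z o)) = A'.d k v (Q' (z o)) := fun o k hk v hv => (hK k hk o v hv).symm
  have hPV := Measure.isProbabilityMeasure_map (μ := P) pop.measurable_V.aemeasurable
  -- The bounds of the effect are cut off outside the cube, where they are arbitrary, to make them
  -- measurable and bounded everywhere.
  set a : Fin N → (Fin J → ℝ) → ℝ := fun o =>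
    (openCube (Fin J)).indicator (lowerDelta A A' I (Q (z o)) (Q' (z o))) with ha
  set b : Fin N → (Fin J → ℝ) → ℝ := fun o =>
    (openCube (Fin J)).indicator (upperDelta A A' I (Q (z o)) (Q' (z o))) with hb
  have hb_neg : ∀ o, b o = fun v =>
      -(openCube (Fin J)).indicator (lowerDelta A' A I (Q' (z o)) (Q (z o))) v := fun o => by
    ext v
    by_cases hv : v ∈ openCube (Fin J) <;> simp [hb, hv, upperDelta_eq_neg]
  have ham : ∀ o, Measurable (a o) := fun o => measurable_indicator_lowerDelta (hKo o) hadm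
  have hbm : ∀ o, Measurable (b o) := fun o => by
    rw [hb_neg]
    exact (measurable_indicator_lowerDelta (hKo' o) hadm).neg
  have hY : 0 ≤ K.card * pop.Ybar := by
    obtain ⟨v, hv⟩ := pop.ae_mem_openCube.exists
    rcases K.eq_empty_or_nonempty with h | ⟨k, -⟩
    · simp [h]
    · exact mul_nonneg (Nat.cast_nonneg _)
        ((pop.mtr_mem k v hv).1.trans (pop.mtr_mem k v hv).2).le
  have haB : ∀ o v, |a o v| ≤ K.card * pop.Ybar := fun o v => by
    by_cases hv : v ∈ openCube (Fin J)
    · simpa [ha, hv] using abs_lowerDelta_le (hKo o) hadm hne hv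
    · simpa [ha, hv] using hY
  have hbB : ∀ o v, |b o v| ≤ K.card * pop.Ybar := fun o v => by
    by_cases hv : v ∈ openCube (Fin J)
    · simpa [hb_neg, hv] using abs_lowerDelta_le (hKo' o) hadm hne hv
    · simpa [hb_neg, hv] using hY
  have hab : ∀ o v, a o v ≤ b o v := fun o v => by
    by_cases hv : v ∈ openCube (Fin J)
    · simpa [ha, hb, hv] using
        (lowerDelta_le (hKo o) hadm hmtr hv).trans (le_upperDelta (hKo o) hadm hmtr hv)
    · simp [ha, hb, hv]
  have haL : popMean (P.map pop.V) w a = ∑ o, w o *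
      ∫ v, lowerDelta A A' I (Q (z o)) (Q' (z o)) v ∂(P.map pop.V) := by
    refine Finset.sum_congr rfl fun o _ => congrArg _ (integral_congr_ae ?_)
    filter_upwards [pop.ae_mem_openCube] with v hv using by simp [ha, hv]
  have hbU : popMean (P.map pop.V) w b = ∑ o, w o *
      ∫ v, upperDelta A A' I (Q (z o)) (Q' (z o)) v ∂(P.map pop.V) := by
    refine Finset.sum_congr rfl fun o _ => congrArg _ (integral_congr_ae ?_)
    filter_upwards [pop.ae_mem_openCube] with v hv using by simp [hb, hv]
  have hmem : ∀ m ∈ I, gprte pop.fV A A' (fun o => Q (z o)) (fun o => Q' (z o)) w m ∈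
      Set.Icc (popMean (P.map pop.V) w a) (popMean (P.map pop.V) w b) := by
    intro m hm
    rw [pop.gprte_eq hK (hadm hm)]
    have hint := fun o => pop.integrable_effectAt (hKo o) (hadm hm)
    have hia : ∀ o, Integrable (a o) (P.map pop.V) := fun o =>
      Integrable.of_bound (ham o).aestronglyMeasurable _ (ae_of_all _ (haB o))
    have hib : ∀ o, Integrable (b o) (P.map pop.V) := fun o =>
      Integrable.of_bound (hbm o).aestronglyMeasurable _ (ae_of_all _ (hbB o))
    constructor
    · refine Finset.sum_le_sum fun o _ => mul_le_mul_of_nonneg_left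
        (integral_mono_ae (hia o) (hint o) ?_) (hw o)
      filter_upwards [pop.ae_mem_openCube] with v hv
      simpa [ha, hv] using lowerDelta_le (hKo o) hadm hm hv
    · refine Finset.sum_le_sum fun o _ => mul_le_mul_of_nonneg_left
        (integral_mono_ae (hint o) (hib o) ?_) (hw o)
      filter_upwards [pop.ae_mem_openCube] with v hv
      simpa [hb, hv] using le_upperDelta (hKo o) hadm hm hv
  refine ⟨hmtr, ?_, fun m hm => haL ▸ hbU ▸ hmem m hm, ?_⟩
  · refine Convex.ordConnected ?_
    rintro _ ⟨m, hm, rfl⟩ _ ⟨n, hn, rfl⟩ s t hs ht hst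
    have hmn := convex_identifiedSet pop A K hm hn hs ht hst
    exact ⟨_, hmn, pop.gprte_combination hK (hadm hm) (hadm hn) (hadm hmn)⟩
  · have hcube : ∀ᵐ ω ∂μ, ∀ p, ξ p ω ∈ openCube (Fin J) := by
      refine ae_all_iff.2 fun p => ae_of_ae_map (hξ_meas p).aemeasurable ?_
      rw [hξ_law]
      exact pop.ae_mem_openCube
    have hdraw : ∀ᵐ ω ∂μ, lo ω = (fun o i => a o (ξ (o, i) ω)) ∧
        up ω = fun o i => b o (ξ (o, i) ω) := by
      filter_upwards [hcube] with ω hω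
      constructor
      · ext o i
        simp [hlo, ha, hω]
      · ext o i
        simp [hup, hb, hω]
    have : Nonempty I := hne.to_subtype
    obtain ⟨p, hp, hlim⟩ := exists_tendsto_iInf_coverage (ι := I) hξ_meas hξ_law hξ_indep hw ham hbm
      haB hbB hab (θ := fun m => gprte pop.fV A A' (fun o => Q (z o)) (fun o => Q' (z o)) w m)
      (fun m => hmem m m.2) hα hα_lt (c := c) (by
        filter_upwards [hdraw] with ω hω M
        have := hc M ω
        rwa [hω.1, hω.2] at this)
    refine ⟨p, hp, hlim.congr fun M => iInf_congr fun m => measureReal_congr ?_⟩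
    filter_upwards [hdraw] with ω hω
    change (_ ∈ confInterval _ _ _ _ _) = (_ ∈ confInterval _ _ _ _ _)
    rw [hω.1, hω.2]
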